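/- Let $N$ be an odd composite nonsquare positive integer, $R^+(N)=\ln(x_1+y_1\sqrt N)$ with $(x_1,y_1)$ the minimal positive solution of $X^2-NY^2=1$, and assume $R^+(N)>(\ln N)^2$. Let $a_m$ be the partial quotients of $\sqrt N$, $\tau$ the period of its continued fraction expansion, and $P_0=0$, $Q_0=1$, $P_{m+1}=a_mQ_m-P_m$, $Q_{m+1}=(N-P_{m+1}^2)/Q_m$. Let $$\Upsilon_m=\big((-1)^mQ_m,\;2P_{m+1},\;(-1)^{m+1}Q_{m+1}\big)\qquad(m\ge 0),$$ binary quadratic forms $(a,b,c)=aX^2+bXY+cY^2$ of discriminant $\Delta=4N$, and put $\mathrm{dist}(N)=R^+(N)/2$ if $\tau$ is even, $\mathrm{dist}(N)=R^+(N)/4$ if $\tau$ is odd. A form $(a,b,c)$ is reduced if $|\sqrt\Delta-2|a||<b<\sqrt\Delta$. The reduction operator is $\rho(a,b,c)=\big(c,r,\tfrac{r^2-\Delta}{4c}\big)$, where $r\equiv -b \pmod{2c}$ and $-|c|<r\le|c|$ if $\sqrt\Delta<|c|$, $\sqrt\Delta-2|c|<r<\sqrt\Delta$ if $|c|<\sqrt\Delta$.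 Put $\delta(F,\rho(F))=\tfrac12\ln\left|\tfrac{b+\sqrt\Delta}{b-\sqrt\Delta}\right|$ for $F=(a,b,c)$, and let the distance along $n$ applications of $\rho$ be $\sum_{i=1}^{n}\delta(\rho^{i-1}(F),\rho^i(F))$; for $G$ in the $\rho$-orbit of $F$, $\delta(F,G)$ is this sum for the least $n\ge0$ with $\rho^n(F)=G$. A Gauss composition of $(a_1,b_1,c_1)$ and $(a_2,b_2,c_2)$ is $(a_3,b_3,c_3)$ with $$a_3=d_0\frac{a_1a_2}{n^2},\quad b_3=b_1+\frac{2a_1}{n}\Big(\frac{s(b_2-b_1)}2-c_1v\Big),\quad c_3=\frac{b_3^2-\Delta}{4a_3},$$ where $\beta=\frac{b_1+b_2}2$, $n=\gcd(a_1,a_2,\beta)$, $d_0=\gcd(a_1,a_2,\beta,c_1,c_2,\frac{b_1-b_2}2)$ and $s,u,v$ are any integers with $a_1s+a_2u+\beta v=n$. A giant step $F\bullet G$ is a Gauss composition $K$ of $F$ and $G$ followed by the least number of applications of $\rho$ which gives a reduced form; let $e$ be the distance along these applications (starting from $K$). Giant-step phase. Let $\ell$ be the least index for which the distance along $\ell$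 applications of $\rho$ to $\Upsilon_0$ is at least $2\ln(4N)+1$; set $G_0=\Upsilon_\ell$ and let $d_0$ be that distance. While $d_i\le\mathrm{dist}(N)$, put $G_{i+1}=G_i\bullet G_i$ and $d_{i+1}=2d_i+e$, with $e$ belonging to this giant step. Let $t$ be the first index with $d_t>\mathrm{dist}(N)$; the phase requires $t\ge1$. Start with $\bar F=G_{t-1}$, $\bar d=d_{t-1}$, and for $i=t-2,\dots,0$: if $\bar d+d_i\le\mathrm{dist}(N)$, replace $\bar F$ by $\bar F\bullet G_i$ and $\bar d$ by $\bar d+d_i$. The output is the final $\bar F$. Claim. There are absolute constants $C$ and $N_0$ such that, for all $N$ as above: if $N\ge N_0$, the phase can be carried out to its end; and every form $\bar F$ that the phase can output (for any choices of the Bézout coefficients) is one of the $\Upsilon_n$ and satisfies $$|\mathrm{dist}(N)-\delta(\Upsilon_0,\bar F)|\le C(\ln N)^2 ,\qquad |\delta(\Upsilon_0,\Upsilon_{\lfloor\tau/2\rfloor})-\delta(\Upsilon_0,\bar F)|\le C(\ln N)^2 .$$ Here $\Upsilon_{\lfloor\tau/2\rfloor}$ is the target form: $\Upsilon_{\tau/2}$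 for even $\tau$, $\Upsilon_{(\tau-1)/2}$ for odd $\tau$. -/

import Mathlib

/-! ### Continued fraction of `√N`, in Lagrange's form -/

/-- The state `(P_m, Q_m)` of the continued fraction algorithm for `√N`, started at `(0, 1)`:
`a_m = ⌊(P_m + √N) / Q_m⌋`, `P_{m+1} = a_m Q_m - P_m`, `Q_{m+1} = (N - P_{m+1}²) / Q_m`
(an exact division). -/
noncomputable def cfPQ (N : ℕ) : ℕ → ℤ × ℤ
  | 0 => (0, 1)
  | m + 1 =>
    let P := (cfPQ N m).1
    let Q := (cfPQ N m).2
    let P' := ⌊((P : ℝ) + Real.sqrt N) / (Q : ℝ)⌋ * Q - P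
    (P', ((N : ℤ) - P' ^ 2) / Q)

noncomputable def cfP (N m : ℕ) : ℤ := (cfPQ N m).1

noncomputable def cfQ (N m : ℕ) : ℤ := (cfPQ N m).2

/-- The partial quotients `a_m` of `√N`. -/
noncomputable def cfA (N m : ℕ) : ℤ := ⌊((cfP N m : ℝ) + Real.sqrt N) / (cfQ N m : ℝ)⌋

/-- The period `τ` of the continued fraction expansion `√N = [a₀; a₁, …, a_τ, a₁, …, a_τ, …]`. -/
noncomputable def cfPeriod (N : ℕ) : ℕ :=
  sInf {k : ℕ | 0 < k ∧ ∀ n : ℕ, 1 ≤ n → cfA N (n + k) = cfA N n}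

/-! ### Binary quadratic forms -/

/-- The binary quadratic form `aX² + bXY + cY²`. -/
@[ext]
structure BQForm where
  a : ℤ
  b : ℤ
  c : ℤ

namespace BQForm

def disc (F : BQForm) : ℤ := F.b ^ 2 - 4 * F.a * F.c

def IsReduced (F : BQForm) : Prop :=
  abs (Real.sqrt F.disc - 2 * abs (F.a : ℝ)) < (F.b : ℝ) ∧ (F.b : ℝ) < Real.sqrt F.disc

/-- `rRes D b c` is the unique integer `r` with `r + b ≡ 0 (mod 2c)` and `-|c| < r ≤ |c|` if
`√D < |c|`, respectively `√D - 2|c| < r < √D` if `|c| < √D` (see `rRes_spec`). -/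
def rRes (D b c : ℤ) : ℤ :=
  let m := if D < c ^ 2 then |c| else Int.sqrt D
  m - (m + b) % (2 * |c|)

theorem rRes_spec {D b c : ℤ} (hD : 0 < D) (hsq : ¬ IsSquare D) (hc : c ≠ 0) (r : ℤ) :
    r = rRes D b c ↔
      (2 * c ∣ r + b ∧
        (Real.sqrt D < |(c : ℝ)| → -|(c : ℝ)| < r ∧ (r : ℝ) ≤ |(c : ℝ)|) ∧
        (|(c : ℝ)| < Real.sqrt D →
          Real.sqrt D - 2 * |(c : ℝ)| < r ∧ (r : ℝ) < Real.sqrt D)) := by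
  have hc2 : 0 < 2 * |c| := by positivity
  have key : ∀ m : ℤ, r = m - (m + b) % (2 * |c|) ↔
      (2 * c ∣ r + b ∧ m - 2 * |c| < r ∧ r ≤ m) := by
    intro m
    have h0 := Int.emod_nonneg (m + b) hc2.ne'
    have h1 := Int.emod_lt_of_pos (m + b) hc2
    have habs : 2 * |c| = |2 * c| := by rw [abs_mul, abs_two]
    constructor
    · intro h
      refine ⟨?_, by linarith, by linarith⟩
      rw [← abs_dvd, ← habs]
      refine ⟨(m + b) / (2 * |c|), ?_⟩
      have := Int.emod_add_mul_ediv (m + b) (2 * |c|)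
      linarith
    · rintro ⟨hd, h2, h3⟩
      rw [← abs_dvd, ← habs] at hd
      have h4 : (m + b) % (2 * |c|) = (m - r) % (2 * |c|) := by
        refine (Int.emod_emod_of_dvd _ dvd_rfl).symm.trans ?_
        rw [Int.emod_emod_of_dvd _ dvd_rfl]
        refine Int.ModEq.symm ((Int.modEq_iff_dvd).2 ?_)
        have : m + b - (m - r) = r + b := by ring
        rwa [this]
      rw [h4, Int.emod_eq_of_lt (by linarith) (by linarith)]
      ring
  have hD' : (0 : ℝ) ≤ (D : ℝ) := by exact_mod_cast hD.le
  have hs2 : Real.sqrt D ^ 2 = (D : ℝ) := Real.sq_sqrt hD'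
  have hs0 := Real.sqrt_nonneg (D : ℝ)
  have hca : (0 : ℝ) ≤ |(c : ℝ)| := abs_nonneg _
  unfold rRes
  by_cases h : D < c ^ 2
  · have hlt : Real.sqrt D < |(c : ℝ)| := by
      rw [Real.sqrt_lt' (by positivity), sq_abs]
      exact_mod_cast h
    simp only [h, if_true]
    rw [key]
    refine and_congr_right fun _ => ?_
    simp only [hlt, hlt.not_gt, forall_true_left, false_imp_iff, and_true]
    have e1 : |(c : ℝ)| = ((|c| : ℤ) : ℝ) := by simp
    rw [e1]
    constructor
    · rintro ⟨h2, h3⟩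
      exact ⟨by exact_mod_cast (by linarith : -|c| < r), by exact_mod_cast h3⟩
    · rintro ⟨h2, h3⟩
      have h2' : -|c| < r := by exact_mod_cast h2
      exact ⟨by linarith, by exact_mod_cast h3⟩
  · have hne : D ≠ c ^ 2 := fun he => hsq ⟨c, by rw [he, sq]⟩
    have hgt : c ^ 2 < D := lt_of_le_of_ne (not_lt.1 h) (Ne.symm hne)
    have hlt : |(c : ℝ)| < Real.sqrt D := by
      rw [Real.lt_sqrt hca, sq_abs]
      exact_mod_cast hgt
    have hfl : ∀ z : ℤ, z ≤ Int.sqrt D ↔ (z : ℝ) < Real.sqrt D := by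
      intro z
      obtain ⟨k, rfl⟩ := Int.eq_ofNat_of_zero_le hD.le
      have hk : Int.sqrt (k : ℤ) = ⌊Real.sqrt (k : ℝ)⌋ := by
        rw [Int.sqrt_natCast, Real.floor_real_sqrt_eq_nat_sqrt]
      rw [hk, Int.le_floor, Int.cast_natCast]
      refine ⟨fun hle => lt_of_le_of_ne hle fun he => hsq ⟨z, ?_⟩, le_of_lt⟩
      have : ((k : ℤ) : ℝ) = ((z * z : ℤ) : ℝ) := by
        rw [← hs2]
        push_cast
        rw [he, sq]
      exact_mod_cast this
    simp only [h, if_false]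
    rw [key]
    refine and_congr_right fun _ => ?_
    simp only [hlt, hlt.not_gt, forall_true_left, false_imp_iff, true_and]
    have e1 : |(c : ℝ)| = ((|c| : ℤ) : ℝ) := by simp
    rw [← hfl]
    refine and_congr_left fun _ => ?_
    have := hfl (r + 2 * |c|)
    push_cast at this
    have h5 : Int.sqrt D - 2 * |c| < r ↔ ¬ (r + 2 * |c| ≤ Int.sqrt D) := by
      rw [not_le]; constructor <;> intro h <;> linarith
    rw [h5, this, not_lt]
    constructor
    · intro h6
      refine lt_of_le_of_ne (by linarith) fun he => hsq ⟨r + 2 * |c|, ?_⟩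
      have h7 : Real.sqrt D = (r : ℝ) + 2 * |(c : ℝ)| := by linarith
      have h8 : ((D : ℤ) : ℝ) = (((r + 2 * |c|) * (r + 2 * |c|) : ℤ) : ℝ) := by
        rw [← hs2, h7]
        push_cast
        ring
      exact_mod_cast h8
    · intro h6
      linarith

/-- The standard reduction operator `ρ` on forms with `ac ≠ 0`. -/
def rho (F : BQForm) : BQForm :=
  let r := rRes F.disc F.b F.c
  ⟨F.c, r, (r ^ 2 - F.disc) / (4 * F.c)⟩

/-- The infrastructural distance `δ(F, ρ(F))`. -/
noncomputable def stepDist (F : BQForm) : ℝ :=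
  1 / 2 * Real.log |((F.b : ℝ) + Real.sqrt F.disc) / ((F.b : ℝ) - Real.sqrt F.disc)|

/-- The distance `∑_{i=1}^{n} δ(ρ^{i-1}(F), ρ^i(F))` travelled by `n` applications of `ρ`. -/
noncomputable def pathDist (F : BQForm) (n : ℕ) : ℝ :=
  ∑ i ∈ Finset.range n, stepDist (rho^[i] F)

/-- The infrastructural distance `δ(F, G)` for `G` in the `ρ`-orbit of `F`: the distance travelled
from `F` until `G` is reached for the first time. -/
noncomputable def delta (F G : BQForm) : ℝ :=
  pathDist F (sInf {n : ℕ | rho^[n] F = G})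

/-- `K` is a Gauss composition of the forms `F = (a₁, b₁, c₁)` and `G = (a₂, b₂, c₂)` of equal
discriminant, for some choice of the Bézout coefficients `s, u, v`. -/
def IsComposition (F G K : BQForm) : Prop :=
  F.disc = G.disc ∧
  ∃ β n d₀ s u v : ℤ,
    β = (F.b + G.b) / 2 ∧
    n = Int.gcd (Int.gcd F.a G.a) β ∧
    d₀ = Int.gcd (Int.gcd (Int.gcd F.a G.a) β)
      (Int.gcd (Int.gcd F.c G.c) ((F.b - G.b) / 2)) ∧
    F.a * s + G.a * u + β * v = n ∧
    K.a = d₀ * (F.a * G.a / n ^ 2) ∧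
    K.b = F.b + 2 * F.a / n * (s * (G.b - F.b) / 2 - F.c * v) ∧
    K.c = (K.b ^ 2 - F.disc) / (4 * K.a)

/-- `H = F • G` is a giant step: a Gauss composition `K` of `F` and `G`, followed by the minimum
number `r` of applications of `ρ` that gives a reduced form; `e = δ(K, H)` is the distance
travelled by these applications. -/
def IsGiantStep (F G H : BQForm) (e : ℝ) : Prop :=
  ∃ (K : BQForm) (r : ℕ), IsComposition F G K ∧
    IsLeast {k : ℕ | (rho^[k] K).IsReduced} r ∧ H = rho^[r] K ∧ e = pathDist K r

end BQForm

/-- The form `Υ_m = ((-1)^m Q_m, 2 P_{m+1}, (-1)^{m+1} Q_{m+1})` of the principal cycle. -/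
noncomputable def upsilon (N m : ℕ) : BQForm :=
  ⟨(-1) ^ m * cfQ N m, 2 * cfP N (m + 1), (-1) ^ (m + 1) * cfQ N (m + 1)⟩

/-! ### The target distance -/

/-- `ln (x + y √N)` for a solution `(x, y)` of `X² - N Y² = 1`; this is `R⁺(N)` when the solution
is the fundamental one. -/
noncomputable def pellLog {N : ℕ} (ε : Pell.Solution₁ (N : ℤ)) : ℝ :=
  Real.log ((ε.x : ℝ) + (ε.y : ℝ) * Real.sqrt N)

/-- `dist(N)`, where `R` stands for `R⁺(N)`. -/
noncomputable def targetDist (N : ℕ) (R : ℝ) : ℝ :=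
  if Even (cfPeriod N) then R / 2 else R / 4

/-! ### The giant-step phase of the algorithm -/

/-- A run of the giant-step phase for `N` with target distance `D`. The state consists of the forms
`G₀, …, G_t` with the accumulated distances `d₀, …, d_t`, and of the successive values `F i`, `dbar i`
of the approximation and its nominal distance: `F (t-1)`, `dbar (t-1)` are the initial values, `F i`,
`dbar i` those after the index `i` has been treated, and `F 0` is the output. -/
structure IsGiantStepRun (N : ℕ) (D : ℝ) (t : ℕ) (G : ℕ → BQForm) (d : ℕ → ℝ)
    (F : ℕ → BQForm) (dbar : ℕ → ℝ) : Prop where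
  /-- `G₀` is the first `Υ_ℓ` at distance at least `2 ln (4N) + 1` from `Υ_0`. -/
  init : ∃ l : ℕ,
    IsLeast {k : ℕ | 2 * Real.log (4 * N) + 1 ≤ (upsilon N 0).pathDist k} l ∧
    G 0 = upsilon N l ∧ d 0 = (upsilon N 0).pathDist l
  /-- The forms `G_i` are obtained by repeated squaring, with their exact distances. -/
  square : ∀ i < t, ∃ e : ℝ,
    BQForm.IsGiantStep (G i) (G i) (G (i + 1)) e ∧ d (i + 1) = 2 * d i + e
  /-- Squaring goes on as long as `d_i ≤ D`; so `d_{t-1} ≤ D < d_t`. -/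
  le_target : ∀ i < t, d i ≤ D
  target_lt : D < d t
  /-- At least `G₀` itself does not overshoot, so that `G_{t-1}` makes sense. -/
  one_le : 1 ≤ t
  start : F (t - 1) = G (t - 1) ∧ dbar (t - 1) = d (t - 1)
  /-- Treatment of the indices `i = t-2, …, 0`. -/
  take : ∀ i, i + 1 < t → dbar (i + 1) + d i ≤ D →
    (∃ e : ℝ, BQForm.IsGiantStep (F (i + 1)) (G i) (F i) e) ∧ dbar i = dbar (i + 1) + d i
  skip : ∀ i, i + 1 < t → D < dbar (i + 1) + d i →
    F i = F (i + 1) ∧ dbar i = dbar (i + 1)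

/-! On `ℤ[√N]` the logarithm L(γ) = ½ ln |γ/γ̄| (`logRatio`) is additive, vanishes on integers and
takes the value R⁺ at the fundamental solution ε. A principal form is the norm form of an oriented
basis (γ, η) (`IsRep`). Its position L(γ) is well defined modulo R⁺ (`exists_logRatio_sub`). A step
of ρ passes from γ to η, and `stepDist` is exactly L(η) − L(γ). Gauss composition multiplies the two
generators and divides by an integer, so positions add exactly (`IsRep.composition`). Reducing a
composition of two reduced forms moves the position by only O(ln N) (`IsRep.exists_reduced`).

The generator of a reduced principal form is a minimal point of the lattice `ℤ[√N]`, hence up to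
sign and units a convergent of √N. So every such form is some Υ_n (`IsRep.exists_cfGen`,
`IsPrincipalAt.exists_upsilon`), and its position is the distance from Υ_0 modulo R⁺.

Therefore d_i is an exact position of G_i. These distances double up to O(ln N), and R⁺ is
polynomially bounded in N (`pellLog_le`), so t = O(ln N). In the descent the nominal distance
ignores the e of each giant step, an error of O(ln N) per step, while the greedy choice leaves a gap
of d_0 + O(t ln N); both are O((ln N)²) (`IsGiantStepRun.approx`). Replacing a position modulo R⁺ by
δ is legitimate when R⁺ exceeds four times the error; otherwise the trivial bound |dist(N) − δ| ≤ R⁺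
is already good enough (`IsGiantStepRun.output`). Finally, the symmetry of the continued fraction
places Υ_⌊τ/2⌋ within one ρ-step of dist(N) (`targetDist_sub_delta`). -/

/-! ### Elements of `ℤ[√N]` attached to principal forms -/

/-- The embedding of `ℤ[√N]` into `ℝ`. -/
noncomputable def sqrtEmbed (N : ℕ) : ℤ√(N : ℤ) →+* ℝ := Zsqrtd.toReal (Int.natCast_nonneg N)

theorem sqrtEmbed_apply {N : ℕ} (γ : ℤ√(N : ℤ)) :
    sqrtEmbed N γ = (γ.re : ℝ) + (γ.im : ℝ) * Real.sqrt N := by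
  simp [sqrtEmbed]

theorem sqrtEmbed_star {N : ℕ} (γ : ℤ√(N : ℤ)) :
    sqrtEmbed N (star γ) = (γ.re : ℝ) - (γ.im : ℝ) * Real.sqrt N := by
  simp [sqrtEmbed_apply, sub_eq_add_neg]

theorem ne_mul_self_of_not_isSquare {N : ℕ} (hN : ¬ IsSquare N) (n : ℤ) : (N : ℤ) ≠ n * n := by
  intro h
  apply hN
  rw [← Int.isSquare_natCast_iff]
  exact ⟨n, h⟩

theorem sqrtEmbed_injective {N : ℕ} (hN : ¬ IsSquare N) : Function.Injective (sqrtEmbed N) :=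
  Zsqrtd.toReal_injective _ (ne_mul_self_of_not_isSquare hN)

theorem sqrtEmbed_ne_zero {N : ℕ} (hN : ¬ IsSquare N) {γ : ℤ√(N : ℤ)} (h : γ ≠ 0) :
    sqrtEmbed N γ ≠ 0 := by
  rwa [Ne, map_eq_zero_iff _ (sqrtEmbed_injective hN)]

theorem sqrtEmbed_star_ne_zero {N : ℕ} (hN : ¬ IsSquare N) {γ : ℤ√(N : ℤ)} (h : γ ≠ 0) :
    sqrtEmbed N (star γ) ≠ 0 :=
  sqrtEmbed_ne_zero hN (star_ne_zero.2 h)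

theorem sqrtd_mul_ne_zero {N : ℕ} (hN : ¬ IsSquare N) {x y : ℤ√(N : ℤ)} (hx : x ≠ 0)
    (hy : y ≠ 0) : x * y ≠ 0 := by
  intro h
  have h1 := congrArg (sqrtEmbed N) h
  rw [map_mul, map_zero] at h1
  exact mul_ne_zero (sqrtEmbed_ne_zero hN hx) (sqrtEmbed_ne_zero hN hy) h1

theorem sqrtd_mul_left_cancel {N : ℕ} (hN : ¬ IsSquare N) {x y z : ℤ√(N : ℤ)} (hx : x ≠ 0)
    (h : x * y = x * z) : y = z := by
  by_contra hyz
  exact sqrtd_mul_ne_zero hN hx (sub_ne_zero.2 hyz) (by rw [mul_sub, h, sub_self])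

theorem sqrtEmbed_mul_star {N : ℕ} (γ : ℤ√(N : ℤ)) :
    sqrtEmbed N γ * sqrtEmbed N (star γ) = γ.norm := by
  rw [← map_mul, ← Zsqrtd.norm_eq_mul_conj, map_intCast]

/-- The logarithmic distance `½ ln |γ / γ̄|`. -/
noncomputable def logRatio {N : ℕ} (γ : ℤ√(N : ℤ)) : ℝ :=
  1 / 2 * Real.log |sqrtEmbed N γ / sqrtEmbed N (star γ)|

theorem logRatio_mul {N : ℕ} (hN : ¬ IsSquare N) {γ η : ℤ√(N : ℤ)} (hγ : γ ≠ 0) (hη : η ≠ 0) :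
    logRatio (γ * η) = logRatio γ + logRatio η := by
  have h1 := sqrtEmbed_ne_zero hN hγ
  have h2 := sqrtEmbed_ne_zero hN hη
  have h3 := sqrtEmbed_star_ne_zero hN hγ
  have h4 := sqrtEmbed_star_ne_zero hN hη
  unfold logRatio
  rw [star_mul', map_mul, map_mul, mul_div_mul_comm, abs_mul, Real.log_mul, mul_add]
  · exact abs_ne_zero.2 (div_ne_zero h1 h3)
  · exact abs_ne_zero.2 (div_ne_zero h2 h4)

theorem logRatio_intCast {N : ℕ} (n : ℤ) : logRatio (n : ℤ√(N : ℤ)) = 0 := by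
  unfold logRatio
  rw [star_intCast, map_intCast]
  rcases eq_or_ne (n : ℝ) 0 with h | h
  · simp [h]
  · simp [div_self h]

theorem logRatio_neg {N : ℕ} (γ : ℤ√(N : ℤ)) : logRatio (-γ) = logRatio γ := by
  unfold logRatio
  rw [star_neg, map_neg, map_neg, neg_div_neg_eq]

theorem logRatio_one {N : ℕ} : logRatio (1 : ℤ√(N : ℤ)) = 0 := by
  simp [logRatio]

/-! ### Principal forms as norm forms of oriented bases -/

namespace BQForm

/-- `F` is the norm form `F(X, Y) = N(γX + ηY)` of an oriented basis `γ, η` of `ℤ[√N]`: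
`F = (N(γ), 2B, N(η))` with `γ̄ η = B + √N`. -/
def IsRep (N : ℕ) (F : BQForm) (γ : ℤ√(N : ℤ)) : Prop :=
  ∃ (η : ℤ√(N : ℤ)) (B : ℤ), star γ * η = ⟨B, 1⟩ ∧ F = ⟨γ.norm, 2 * B, η.norm⟩

theorem norm_mul_norm_of_basis {N : ℕ} {γ η : ℤ√(N : ℤ)} {B : ℤ} (h : star γ * η = ⟨B, 1⟩) :
    γ.norm * η.norm = B ^ 2 - N := by
  have := congrArg Zsqrtd.norm h
  rw [Zsqrtd.norm_mul, Zsqrtd.norm_conj] at this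
  rw [this, Zsqrtd.norm_def]
  ring

theorem IsRep.disc_eq {N : ℕ} {F : BQForm} {γ : ℤ√(N : ℤ)} (h : F.IsRep N γ) :
    F.disc = 4 * N := by
  obtain ⟨η, B, h1, rfl⟩ := h
  have := norm_mul_norm_of_basis h1
  simp only [disc]
  linarith

theorem IsRep.ne_zero {N : ℕ} {F : BQForm} {γ : ℤ√(N : ℤ)} (h : F.IsRep N γ) : γ ≠ 0 := by
  rintro rfl
  obtain ⟨η, B, h1, -⟩ := h
  rw [star_zero, zero_mul] at h1
  simpa using congrArg Zsqrtd.im h1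

theorem basis_snd_ne_zero {N : ℕ} {γ η : ℤ√(N : ℤ)} {B : ℤ} (h : star γ * η = ⟨B, 1⟩) :
    η ≠ 0 := by
  rintro rfl
  rw [mul_zero] at h
  simpa using congrArg Zsqrtd.im h

theorem IsRep.a_ne_zero {N : ℕ} (hN : ¬ IsSquare N) {F : BQForm} {γ : ℤ√(N : ℤ)}
    (h : F.IsRep N γ) : F.a ≠ 0 := by
  have h0 := h.ne_zero
  obtain ⟨η, B, h1, rfl⟩ := h
  exact fun h => h0 ((Zsqrtd.norm_eq_zero (ne_mul_self_of_not_isSquare hN) γ).1 h)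

theorem IsRep.c_ne_zero {N : ℕ} (hN : ¬ IsSquare N) {F : BQForm} {γ : ℤ√(N : ℤ)}
    (h : F.IsRep N γ) : F.c ≠ 0 := by
  obtain ⟨η, B, h1, rfl⟩ := h
  exact fun h => basis_snd_ne_zero h1
    ((Zsqrtd.norm_eq_zero (ne_mul_self_of_not_isSquare hN) η).1 h)

/-- The coordinates of a basis. -/
theorem basis_coords {N : ℕ} {γ η : ℤ√(N : ℤ)} {B : ℤ} (h : star γ * η = ⟨B, 1⟩) :
    γ.re * η.re - N * γ.im * η.im = B ∧ γ.re * η.im - γ.im * η.re = 1 := by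
  have h1 := congrArg Zsqrtd.re h
  have h2 := congrArg Zsqrtd.im h
  simp at h1 h2
  constructor <;> linarith

/-- Equivalently γ = a·η.im + γ.im·(−B + √N) with a = N(γ), so γ lies in the ideal (a, −B + √N).
This makes the divisibilities in `IsRep.exists_unit` and `IsRep.composition` explicit. -/
theorem basis_re_eq {N : ℕ} {γ η : ℤ√(N : ℤ)} {B : ℤ} (h : star γ * η = ⟨B, 1⟩) :
    γ.re = γ.norm * η.im - B * γ.im := by
  obtain ⟨h1, h2⟩ := basis_coords h
  rw [← h1, Zsqrtd.norm_def]
  linear_combination (-γ.re) * h2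

theorem IsRep.neg {N : ℕ} {F : BQForm} {γ : ℤ√(N : ℤ)} (h : F.IsRep N γ) : F.IsRep N (-γ) := by
  obtain ⟨η, B, h1, rfl⟩ := h
  exact ⟨-η, B, by rw [star_neg, neg_mul_neg, h1], by rw [Zsqrtd.norm_neg, Zsqrtd.norm_neg]⟩

theorem IsRep.mul_unit {N : ℕ} {F : BQForm} {γ u : ℤ√(N : ℤ)} (h : F.IsRep N γ)
    (hu : u.norm = 1) : F.IsRep N (u * γ) := by
  obtain ⟨η, B, h1, rfl⟩ := h
  refine ⟨u * η, B, ?_, by rw [Zsqrtd.norm_mul, Zsqrtd.norm_mul, hu, one_mul, one_mul]⟩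
  have h2 : u * star u = 1 := by rw [← Zsqrtd.norm_eq_mul_conj, hu, Int.cast_one]
  rw [star_mul', ← h1]
  linear_combination (star γ * η) * h2

/-- Both γ and γ' generate the ideal (a, −B + √N) read off from the form, so they differ by a unit;
its norm is 1 because N(γ) = a = N(γ'). -/
theorem IsRep.exists_unit {N : ℕ} (hN : ¬ IsSquare N) {F : BQForm} {γ γ' : ℤ√(N : ℤ)}
    (h : F.IsRep N γ) (h' : F.IsRep N γ') : ∃ u : ℤ√(N : ℤ), u.norm = 1 ∧ γ' = u * γ := by
  have ha := h.a_ne_zero hN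
  obtain ⟨η, B, h1, rfl⟩ := h
  obtain ⟨η', B', h1', h2⟩ := h'
  simp only [BQForm.mk.injEq] at h2 ha
  obtain ⟨hn, hB, hn'⟩ := h2
  obtain rfl : B = B' := by linarith
  have e := basis_re_eq h1
  have e' := basis_re_eq h1'
  rw [← hn] at e'
  have hac := norm_mul_norm_of_basis h1
  have hsq : (N : ℤ) = B ^ 2 - γ.norm * η.norm := by linarith
  obtain ⟨u, hu⟩ : ∃ u : ℤ√(N : ℤ), γ' * star γ = (γ.norm : ℤ) * u := by
    -- The product γ'·γ̄ with both real parts eliminated by `basis_re_eq` and N = B² − ac, divided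
    -- by a.
    refine ⟨⟨γ.norm * η'.im * η.im - η'.im * B * γ.im - B * γ'.im * η.im + η.norm * γ'.im * γ.im,
      γ'.im * η.im - η'.im * γ.im⟩, ?_⟩
    ext
    · simp
      linear_combination (γ.norm * η.im - B * γ.im) * e' + γ'.re * e - γ'.im * γ.im * hsq
    · simp
      linear_combination γ'.im * e - γ.im * e'
  have h4 := congrArg Zsqrtd.norm hu
  rw [Zsqrtd.norm_mul, Zsqrtd.norm_mul, Zsqrtd.norm_conj, ← hn, Zsqrtd.norm_intCast] at h4
  refine ⟨u, ?_, ?_⟩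
  · exact mul_left_cancel₀ (mul_ne_zero ha ha) (by linarith)
  · have h5 : ((γ.norm : ℤ) : ℤ√(N : ℤ)) ≠ 0 := by exact_mod_cast ha
    apply sqrtd_mul_left_cancel hN h5
    rw [← mul_assoc, ← hu, Zsqrtd.norm_eq_mul_conj]
    ring

/-- For fixed γ the second basis vector is determined up to adding multiples of γ, and each such
multiple shifts b by a multiple of 2a. -/
theorem IsRep.eq_of_dvd {N : ℕ} {F F' : BQForm} {γ : ℤ√(N : ℤ)}
    (h : F.IsRep N γ) (h' : F'.IsRep N γ) : F.a = F'.a ∧ 2 * F.a ∣ F.b - F'.b := by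
  obtain ⟨η, B, h1, rfl⟩ := h
  obtain ⟨η', B', h1', rfl⟩ := h'
  refine ⟨rfl, ?_⟩
  have e := basis_re_eq h1
  have e' := basis_re_eq h1'
  obtain ⟨g1, g2⟩ := basis_coords h1
  obtain ⟨g1', g2'⟩ := basis_coords h1'
  refine ⟨η'.im * η.re - η.im * η'.re, ?_⟩
  simp only
  have : γ.norm = γ.re * γ.re - N * γ.im * γ.im := Zsqrtd.norm_def _
  rw [this, ← g1, ← g1']
  linear_combination 2 * (γ.re * η.re - N * γ.im * η.im) * (-g2') +
    2 * (γ.re * η'.re - N * γ.im * η'.im) * g2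

/-! ### Composition -/

/-- The generator of K is γ₁γ₂/n, and the integer n does not affect `logRatio`. The second basis
vector is sγ₁η₂ + uγ₂η₁ + vη₁η₂: multiplied by the conjugate of γ₁γ₂ its √N-coefficient is a₁s + a₂u
+ βv = n, so the Bézout relation is precisely what makes the basis oriented. -/
theorem IsRep.composition {N : ℕ} (hN : ¬ IsSquare N) {F G K : BQForm} {γ₁ γ₂ : ℤ√(N : ℤ)}
    (h₁ : F.IsRep N γ₁) (h₂ : G.IsRep N γ₂) (hK : IsComposition F G K) :
    |K.a| ≤ |F.a * G.a| ∧
    ∃ γ : ℤ√(N : ℤ), K.IsRep N γ ∧ logRatio γ = logRatio γ₁ + logRatio γ₂ := by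
  have ha₁ := h₁.a_ne_zero hN
  have ha₂ := h₂.a_ne_zero hN
  have hγ₁ := h₁.ne_zero
  have hγ₂ := h₂.ne_zero
  have hdisc := h₁.disc_eq
  obtain ⟨η₁, B₁, e₁, rfl⟩ := h₁
  obtain ⟨η₂, B₂, e₂, rfl⟩ := h₂
  obtain ⟨-, β, n, d₀, s, u, v, hβ, hn, hd, hbez, hKa, hKb, hKc⟩ := hK
  rw [hdisc] at hKc
  simp only at ha₁ ha₂ hβ hn hd hbez hKa hKb hKc ⊢
  have hβ' : β = B₁ + B₂ := by omega
  have hdiff : (2 * B₁ - 2 * B₂) / 2 = B₁ - B₂ := by omega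
  have hac₁ := norm_mul_norm_of_basis e₁
  obtain ⟨c11, c12⟩ := basis_coords e₁
  have r₁ := basis_re_eq e₁
  have r₂ := basis_re_eq e₂
  -- F is primitive: it takes the value N(1) = 1 at the coordinates of 1 = η₁.im·γ₁ − γ₁.im·η₁,
  -- while d₀ divides all its coefficients.
  have hd1 : d₀ = 1 := by
    have k1 : d₀ ∣ γ₁.norm := by
      rw [hd]; exact (Int.gcd_dvd_left _ _).trans ((Int.gcd_dvd_left _ _).trans (Int.gcd_dvd_left _ _))
    have k2 : d₀ ∣ B₁ + B₂ := by
      rw [hd, ← hβ']; exact (Int.gcd_dvd_left _ _).trans (Int.gcd_dvd_right _ _)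
    have k3 : d₀ ∣ η₁.norm := by
      rw [hd]; exact (Int.gcd_dvd_right _ _).trans ((Int.gcd_dvd_left _ _).trans (Int.gcd_dvd_left _ _))
    have k4 : d₀ ∣ B₁ - B₂ := by
      rw [hd, ← hdiff]; exact (Int.gcd_dvd_right _ _).trans (Int.gcd_dvd_right _ _)
    have k5 : d₀ ∣ 2 * B₁ := by
      have := dvd_add k2 k4
      have e : B₁ + B₂ + (B₁ - B₂) = 2 * B₁ := by ring
      rwa [e] at this
    have k6 : γ₁.norm * η₁.im ^ 2 - 2 * B₁ * (η₁.im * γ₁.im) + η₁.norm * γ₁.im ^ 2 = 1 := by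
      rw [Zsqrtd.norm_def, Zsqrtd.norm_def, ← c11]
      linear_combination (γ₁.re * η₁.im - γ₁.im * η₁.re + 1) * c12
    have k7 : d₀ ∣ 1 := by
      rw [← k6]
      exact dvd_add (dvd_sub (k1.mul_right _) (k5.mul_right _)) (k3.mul_right _)
    have : 0 ≤ d₀ := by rw [hd]; positivity
    exact Int.eq_one_of_dvd_one this k7
  have hn0 : n ≠ 0 := by
    rw [hn]
    intro h
    have h' := Int.natCast_eq_zero.1 h
    rw [Int.gcd_eq_zero_iff] at h'
    have h'' := Int.natCast_eq_zero.1 h'.1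
    rw [Int.gcd_eq_zero_iff] at h''
    exact ha₁ h''.1
  obtain ⟨a₁, ha₁'⟩ : n ∣ γ₁.norm := by
    rw [hn]; exact (Int.gcd_dvd_left _ _).trans (Int.gcd_dvd_left _ _)
  obtain ⟨a₂, ha₂'⟩ : n ∣ γ₂.norm := by
    rw [hn]; exact (Int.gcd_dvd_left _ _).trans (Int.gcd_dvd_right _ _)
  obtain ⟨b, hb⟩ : n ∣ B₁ + B₂ := by
    rw [← hβ', hn]; exact (Int.gcd_dvd_right _ _)
  have hNeq : (N : ℤ) = B₁ ^ 2 - n * a₁ * η₁.norm := by rw [← ha₁']; linarith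
  have hB₂ : B₂ = n * b - B₁ := by linarith
  rw [ha₁'] at r₁
  rw [ha₂'] at r₂
  obtain ⟨γ, hγ⟩ : ∃ γ : ℤ√(N : ℤ), γ₁ * γ₂ = (n : ℤ) * γ := by
    refine ⟨⟨n * a₁ * η₁.im * a₂ * η₂.im - a₁ * η₁.im * B₂ * γ₂.im - a₂ * η₂.im * B₁ * γ₁.im +
      (b * B₁ - a₁ * η₁.norm) * γ₁.im * γ₂.im,
      a₁ * η₁.im * γ₂.im + a₂ * η₂.im * γ₁.im - b * γ₁.im * γ₂.im⟩, ?_⟩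
    ext
    · simp only [Zsqrtd.re_mul, Zsqrtd.re_intCast, Zsqrtd.im_intCast]
      rw [r₁, r₂, hB₂]
      linear_combination γ₁.im * γ₂.im * hNeq
    · simp only [Zsqrtd.im_mul, Zsqrtd.re_intCast, Zsqrtd.im_intCast]
      rw [r₁, r₂, hB₂]
      ring
  have hnorm : γ.norm = a₁ * a₂ := by
    have := congrArg Zsqrtd.norm hγ
    rw [Zsqrtd.norm_mul, Zsqrtd.norm_mul, Zsqrtd.norm_intCast, ha₁', ha₂'] at this
    exact mul_left_cancel₀ (mul_ne_zero hn0 hn0) (by linarith)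
  have hγ0 : γ ≠ 0 := by
    rintro rfl
    rw [mul_zero] at hγ
    exact sqrtd_mul_ne_zero hN hγ₁ hγ₂ hγ
  have hKa' : K.a = γ.norm := by
    rw [hKa, hd1, hnorm, ha₁', ha₂', show n * a₁ * (n * a₂) = a₁ * a₂ * n ^ 2 by ring,
      Int.mul_ediv_cancel _ (pow_ne_zero 2 hn0), one_mul]
  set B₃ := B₁ + a₁ * (s * (B₂ - B₁) - η₁.norm * v) with hB₃
  have hKb' : K.b = 2 * B₃ := by
    rw [hKb, ha₁', show 2 * (n * a₁) = 2 * a₁ * n by ring, Int.mul_ediv_cancel _ hn0,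
      show s * (2 * B₂ - 2 * B₁) = s * (B₂ - B₁) * 2 by ring, Int.mul_ediv_cancel _ two_ne_zero, hB₃]
    ring
  have hbas : star γ * (s * γ₁ * η₂ + u * γ₂ * η₁ + v * η₁ * η₂) = (⟨B₃, 1⟩ : ℤ√(N : ℤ)) := by
    have hn0' : ((n : ℤ) : ℤ√(N : ℤ)) ≠ 0 := by exact_mod_cast hn0
    apply sqrtd_mul_left_cancel hN hn0'
    have hs := congrArg star hγ
    rw [star_mul', star_mul', star_intCast] at hs
    rw [← mul_assoc, ← hs]
    have m₁ : star γ₁ * γ₁ = ((n * a₁ : ℤ) : ℤ√(N : ℤ)) := by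
      rw [← ha₁', Zsqrtd.norm_eq_mul_conj, mul_comm]
    have m₂ : star γ₂ * γ₂ = ((n * a₂ : ℤ) : ℤ√(N : ℤ)) := by
      rw [← ha₂', Zsqrtd.norm_eq_mul_conj, mul_comm]
    have : star γ₁ * star γ₂ * (s * γ₁ * η₂ + u * γ₂ * η₁ + v * η₁ * η₂) =
        s * (star γ₁ * γ₁) * (star γ₂ * η₂) + u * (star γ₂ * γ₂) * (star γ₁ * η₁) +
          v * (star γ₁ * η₁) * (star γ₂ * η₂) := by ring
    rw [this, m₁, m₂, e₁, e₂]
    rw [ha₁', ha₂', hβ'] at hbez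
    ext
    · simp
      rw [hB₃]
      linear_combination v * hNeq + B₁ * hbez
    · simp
      linear_combination hbez
  refine ⟨?_, γ, ⟨_, B₃, hbas, ?_⟩, ?_⟩
  · rw [hKa', hnorm, ha₁', ha₂', show n * a₁ * (n * a₂) = n ^ 2 * (a₁ * a₂) by ring, abs_mul (n ^ 2)]
    exact le_of_eq_of_le (one_mul _).symm
      (mul_le_mul_of_nonneg_right (Int.one_le_abs (pow_ne_zero 2 hn0)) (abs_nonneg _))
  · have hac := norm_mul_norm_of_basis hbas
    ext
    · exact hKa'
    · exact hKb'
    · rw [hKc, hKa', hKb']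
      simp only
      have : (2 * B₃) ^ 2 - 4 * N = 4 * γ.norm *
          (s * γ₁ * η₂ + u * γ₂ * η₁ + v * η₁ * η₂ : ℤ√(N : ℤ)).norm := by linarith
      rw [this, Int.mul_ediv_cancel_left]
      rw [← hKa', hKa']
      intro h
      exact hγ0 ((Zsqrtd.norm_eq_zero (ne_mul_self_of_not_isSquare hN) γ).1 (by linarith))
  · have hn0' : ((n : ℤ) : ℤ√(N : ℤ)) ≠ 0 := by exact_mod_cast hn0
    rw [← logRatio_mul hN hγ₁ hγ₂, hγ, logRatio_mul hN hn0' hγ0, logRatio_intCast, zero_add]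

theorem exists_isComposition {F G : BQForm} (h : F.disc = G.disc) :
    ∃ K, IsComposition F G K := by
  have h1 := Int.gcd_eq_gcd_ab (Int.gcd F.a G.a) ((F.b + G.b) / 2)
  have h2 := Int.gcd_eq_gcd_ab F.a G.a
  set p := Int.gcdA (Int.gcd F.a G.a) ((F.b + G.b) / 2)
  set q := Int.gcdB (Int.gcd F.a G.a) ((F.b + G.b) / 2)
  refine ⟨⟨_, _, (_ ^ 2 - F.disc) / (4 * _)⟩, h, _, _, _, Int.gcdA F.a G.a * p, Int.gcdB F.a G.a * p, q, rfl, rfl, rfl, ?_,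
    rfl, rfl, rfl⟩
  rw [h1]
  linear_combination (-p) * h2

end BQForm

/-! ### The reduction operator -/

theorem one_lt_sqrt_of_not_isSquare {N : ℕ} (hN : ¬ IsSquare N) : 1 < Real.sqrt N := by
  have : 2 ≤ N := by
    rcases N with _ | _ | N
    · exact absurd ⟨0, rfl⟩ hN
    · exact absurd ⟨1, rfl⟩ hN
    · omega
  rw [Real.lt_sqrt zero_le_one]
  have : (2 : ℝ) ≤ N := by exact_mod_cast this
  linarith

theorem not_isSquare_four_mul {N : ℕ} (hN : ¬ IsSquare N) : ¬ IsSquare (4 * N : ℤ) := by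
  rintro ⟨c, hc⟩
  obtain ⟨d, rfl⟩ : (2 : ℤ) ∣ c := by
    have : (2 : ℤ) ∣ c ^ 2 := ⟨2 * N, by linarith⟩
    exact Int.prime_two.dvd_of_dvd_pow this
  exact ne_mul_self_of_not_isSquare hN d (by linarith)

theorem two_mul_sqrt_ne {N : ℕ} (hN : ¬ IsSquare N) (c : ℤ) : 2 * Real.sqrt N ≠ |(c : ℝ)| := by
  intro h
  apply not_isSquare_four_mul hN
  refine ⟨c, ?_⟩
  have h1 : (2 * Real.sqrt N) ^ 2 = (c : ℝ) ^ 2 := by rw [h, sq_abs]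
  rw [mul_pow, Real.sq_sqrt (Nat.cast_nonneg N)] at h1
  have : ((4 * N : ℤ) : ℝ) = ((c * c : ℤ) : ℝ) := by push_cast; linarith
  exact_mod_cast this

theorem abs_log_div_le {u v M : ℝ} (hu : 0 < u) (hv : 0 < v) (h1 : u ≤ M * v) (h2 : v ≤ M * u) :
    |Real.log (u / v)| ≤ Real.log M := by
  have hM : 0 < M := pos_of_mul_pos_left (hu.trans_le h1) hv.le
  rw [abs_le]
  constructor
  · rw [← Real.log_inv]
    apply Real.log_le_log (by positivity)
    rw [inv_le_comm₀ hM (by positivity), inv_div, div_le_iff₀ hu]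
    exact h2
  · apply Real.log_le_log (by positivity)
    rwa [div_le_iff₀ hv]

namespace BQForm

variable {N : ℕ} {F : BQForm} {γ : ℤ√(N : ℤ)}

theorem IsRep.sqrt_disc (h : F.IsRep N γ) : Real.sqrt F.disc = 2 * Real.sqrt N := by
  rw [h.disc_eq]
  push_cast
  rw [Real.sqrt_mul (by norm_num), show (4 : ℝ) = 2 ^ 2 by norm_num, Real.sqrt_sq (by norm_num)]

theorem IsRep.sq_sub (h : F.IsRep N γ) :
    (F.b : ℝ) ^ 2 - 4 * F.a * F.c = 4 * Real.sqrt N ^ 2 := by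
  have := h.disc_eq
  rw [disc] at this
  rw [Real.sq_sqrt (Nat.cast_nonneg N)]
  exact_mod_cast this

theorem IsRep.mul_eq (h : F.IsRep N γ) :
    ((F.b : ℝ) + 2 * Real.sqrt N) * (F.b - 2 * Real.sqrt N) = 4 * F.a * F.c := by
  linarith [h.sq_sub]

theorem IsRep.abs_mul_eq (h : F.IsRep N γ) :
    |(F.b : ℝ) + 2 * Real.sqrt N| * |F.b - 2 * Real.sqrt N| = 4 * |(F.a : ℝ)| * |(F.c : ℝ)| := by
  rw [← abs_mul, h.mul_eq, abs_mul, abs_mul, abs_of_pos (by norm_num : (0 : ℝ) < 4)]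

theorem IsRep.one_le_abs_a (hN : ¬ IsSquare N) (h : F.IsRep N γ) : 1 ≤ |(F.a : ℝ)| := by
  exact_mod_cast Int.one_le_abs (h.a_ne_zero hN)

theorem IsRep.one_le_abs_c (hN : ¬ IsSquare N) (h : F.IsRep N γ) : 1 ≤ |(F.c : ℝ)| := by
  exact_mod_cast Int.one_le_abs (h.c_ne_zero hN)

theorem IsRep.rRes_spec (hN : ¬ IsSquare N) (h : F.IsRep N γ) :
    2 * F.c ∣ (rho F).b + F.b ∧
      (2 * Real.sqrt N < |(F.c : ℝ)| → |((rho F).b : ℝ)| ≤ |(F.c : ℝ)|) ∧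
      (|(F.c : ℝ)| < 2 * Real.sqrt N →
        2 * Real.sqrt N - 2 * |(F.c : ℝ)| < (rho F).b ∧ ((rho F).b : ℝ) < 2 * Real.sqrt N) := by
  have hD : 0 < F.disc := by
    rw [h.disc_eq]
    have := one_lt_sqrt_of_not_isSquare hN
    rw [Real.lt_sqrt zero_le_one] at this
    have : (0 : ℝ) < N := by linarith
    have : 0 < N := by exact_mod_cast this
    omega
  have hsq : ¬ IsSquare F.disc := by rw [h.disc_eq]; exact not_isSquare_four_mul hN
  have := (BQForm.rRes_spec hD hsq (h.c_ne_zero hN) (b := F.b) _).1 rfl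
  rw [h.sqrt_disc] at this
  refine ⟨this.1, fun hc => ?_, this.2.2⟩
  obtain ⟨h1, h2⟩ := this.2.1 hc
  exact abs_le.2 ⟨h1.le, h2⟩

/-- Divide γ̄η = B + √N by its conjugate γη̄ = B − √N: the quotient is (η/η̄)·(γ̄/γ). -/
theorem logRatio_of_basis (hN : ¬ IsSquare N) {γ η : ℤ√(N : ℤ)} {B : ℤ}
    (e : star γ * η = ⟨B, 1⟩) :
    logRatio η = logRatio γ + stepDist ⟨γ.norm, 2 * B, η.norm⟩ := by
  have h : IsRep N ⟨γ.norm, 2 * B, η.norm⟩ γ := ⟨η, B, e, rfl⟩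
  have hγ := h.ne_zero
  have hη := basis_snd_ne_zero e
  rw [stepDist, h.sqrt_disc]
  have h1 := sqrtEmbed_ne_zero hN hγ
  have h2 := sqrtEmbed_ne_zero hN hη
  have h3 := sqrtEmbed_star_ne_zero hN hγ
  have h4 := sqrtEmbed_star_ne_zero hN hη
  have e1 := congrArg (sqrtEmbed N) e
  have e2 := congrArg (fun x => sqrtEmbed N (star x)) e
  simp only [sqrtEmbed_star, star_mul', star_star, map_mul] at e1 e2
  rw [← sqrtEmbed_star η] at e2
  rw [← sqrtEmbed_star γ] at e1
  rw [sqrtEmbed_apply ⟨B, 1⟩] at e1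
  simp only [Int.cast_one, one_mul] at e1 e2
  have e3 : ((2 * B : ℤ) : ℝ) + 2 * Real.sqrt N =
      2 * (sqrtEmbed N (star γ) * sqrtEmbed N η) := by rw [e1]; push_cast; ring
  have e4 : ((2 * B : ℤ) : ℝ) - 2 * Real.sqrt N =
      2 * (sqrtEmbed N γ * sqrtEmbed N (star η)) := by rw [e2]; push_cast; ring
  simp only
  rw [e3, e4, logRatio, logRatio, ← mul_add, ← Real.log_mul, ← abs_mul]
  · congr 3
    field_simp
  · exact abs_ne_zero.2 (div_ne_zero h1 h3)
  · exact abs_ne_zero.2 (div_ne_zero (by simp [h3, h2]) (by simp [h1, h4]))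

/-- ρ replaces the basis (γ, η) by (η, −γ + kη), where r + b = 2ck. -/
theorem IsRep.rho (hN : ¬ IsSquare N) (h : F.IsRep N γ) :
    ∃ η, (rho F).IsRep N η ∧ logRatio η = logRatio γ + stepDist F := by
  obtain ⟨⟨k, hk⟩, -, -⟩ := h.rRes_spec hN
  have hc0 := h.c_ne_zero hN
  have hdisc := h.disc_eq
  obtain ⟨η, B, e, rfl⟩ := h
  simp only at hk hc0
  have key : star η * (-γ + k * η) = (⟨-B + k * η.norm, 1⟩ : ℤ√(N : ℤ)) := by
    have e' := congrArg star e
    rw [star_mul', star_star] at e'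
    have : star η * (-γ + k * η) = -(γ * star η) + k * (η * star η) := by ring
    rw [this, e', ← Zsqrtd.norm_eq_mul_conj]
    ext <;> simp
  refine ⟨η, ⟨-γ + k * η, -B + k * η.norm, key, ?_⟩, logRatio_of_basis hN e⟩
  have hb : (BQForm.rho ⟨γ.norm, 2 * B, η.norm⟩).b = 2 * (-B + k * η.norm) := by linarith
  have hn := norm_mul_norm_of_basis key
  ext
  · rfl
  · exact hb
  · change ((BQForm.rho ⟨γ.norm, 2 * B, η.norm⟩).b ^ 2 - disc _) / (4 * η.norm) = _
    rw [hb, hdisc, show (2 * (-B + k * η.norm)) ^ 2 - 4 * (N : ℤ) =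
      4 * η.norm * (-γ + k * η : ℤ√(N : ℤ)).norm by linarith, Int.mul_ediv_cancel_left]
    exact mul_ne_zero four_ne_zero hc0

theorem IsRep.iterate_rho (hN : ¬ IsSquare N) (h : F.IsRep N γ) (k : ℕ) :
    ∃ η, (BQForm.rho^[k] F).IsRep N η ∧ logRatio η = logRatio γ + pathDist F k := by
  induction k with
  | zero => exact ⟨γ, h, by simp [pathDist]⟩
  | succ k ih =>
    obtain ⟨η, h1, h2⟩ := ih
    obtain ⟨ξ, h3, h4⟩ := h1.rho hN
    refine ⟨ξ, by rwa [Function.iterate_succ_apply'], ?_⟩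
    rw [h4, h2, pathDist, pathDist, Finset.sum_range_succ, add_assoc]

/-! ### Bounds for the distance travelled during reduction -/

theorem IsRep.stepDist_eq (h : F.IsRep N γ) :
    stepDist F = 1 / 2 *
      Real.log (|(F.b : ℝ) + 2 * Real.sqrt N| / |(F.b : ℝ) - 2 * Real.sqrt N|) := by
  rw [stepDist, h.sqrt_disc, abs_div]

theorem IsRep.abs_pos (hN : ¬ IsSquare N) (h : F.IsRep N γ) :
    0 < |(F.b : ℝ) + 2 * Real.sqrt N| ∧ 0 < |(F.b : ℝ) - 2 * Real.sqrt N| := by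
  have h1 := h.abs_mul_eq
  have h2 := h.one_le_abs_a hN
  have h3 := h.one_le_abs_c hN
  have h4 : 0 < |(F.b : ℝ) + 2 * Real.sqrt N| * |F.b - 2 * Real.sqrt N| := by
    rw [h1]; positivity
  exact ⟨pos_of_mul_pos_left h4 (abs_nonneg _), pos_of_mul_pos_right h4 (abs_nonneg _)⟩

/-- The constant 3 comes from |b| + 2√N ≤ 3(|b| − 2√N), which is the same as |b| ≥ 4√N. That 3 < 4
is essential in `IsRep.exists_reduced_of_normalized`. -/
theorem IsRep.abs_stepDist_le_of_large (hN : ¬ IsSquare N) (h : F.IsRep N γ)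
    (hb : 4 * Real.sqrt N ≤ |(F.b : ℝ)|) : |stepDist F| ≤ 1 / 2 * Real.log 3 := by
  have hs := one_lt_sqrt_of_not_isSquare hN
  obtain ⟨h1, h2⟩ := h.abs_pos hN
  rw [h.stepDist_eq, abs_mul, abs_of_pos (by norm_num : (0 : ℝ) < 1 / 2)]
  refine mul_le_mul_of_nonneg_left (abs_log_div_le h1 h2 ?_ ?_) (by norm_num)
  · rcases abs_cases (F.b : ℝ) with h | h <;>
    rcases abs_cases ((F.b : ℝ) + 2 * Real.sqrt N) with h' | h' <;>
    rcases abs_cases ((F.b : ℝ) - 2 * Real.sqrt N) with h'' | h'' <;> linarith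
  · rcases abs_cases (F.b : ℝ) with h | h <;>
    rcases abs_cases ((F.b : ℝ) + 2 * Real.sqrt N) with h' | h' <;>
    rcases abs_cases ((F.b : ℝ) - 2 * Real.sqrt N) with h'' | h'' <;> linarith

theorem log_six_sqrt_pos (hN : ¬ IsSquare N) : 0 < Real.log (6 * Real.sqrt N) :=
  Real.log_pos (by linarith [one_lt_sqrt_of_not_isSquare hN])

/-- If |b| ≤ 4√N, both |b ± 2√N| are at most 6√N, and their product 4|ac| is at least 1; hence their
ratio is at most (6√N)². -/
theorem IsRep.abs_stepDist_le (hN : ¬ IsSquare N) (h : F.IsRep N γ) :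
    |stepDist F| ≤ Real.log (6 * Real.sqrt N) := by
  have hs := one_lt_sqrt_of_not_isSquare hN
  rcases le_total (4 * Real.sqrt N) |(F.b : ℝ)| with hb | hb
  · refine (h.abs_stepDist_le_of_large hN hb).trans ?_
    have h1 : Real.log 3 ≤ Real.log (6 * Real.sqrt N) :=
      Real.log_le_log (by norm_num) (by linarith)
    have h2 : 0 < Real.log 3 := Real.log_pos (by norm_num)
    linarith
  · obtain ⟨h1, h2⟩ := h.abs_pos hN
    have h3 : 1 ≤ |(F.b : ℝ) + 2 * Real.sqrt N| * |F.b - 2 * Real.sqrt N| := by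
      rw [h.abs_mul_eq]
      nlinarith [h.one_le_abs_a hN, h.one_le_abs_c hN]
    have hu : |(F.b : ℝ) + 2 * Real.sqrt N| ≤ 6 * Real.sqrt N := by
      rw [abs_le] at hb ⊢
      constructor <;> linarith
    have hv : |(F.b : ℝ) - 2 * Real.sqrt N| ≤ 6 * Real.sqrt N := by
      rw [abs_le] at hb ⊢
      constructor <;> linarith
    rw [h.stepDist_eq, abs_mul, abs_of_pos (by norm_num : (0 : ℝ) < 1 / 2)]
    have h5 := abs_log_div_le (M := (6 * Real.sqrt N) ^ 2) h1 h2 ?_ ?_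
    · rw [Real.log_pow] at h5
      push_cast at h5
      linarith
    · generalize |(F.b : ℝ) + 2 * Real.sqrt N| = u at *
      generalize |(F.b : ℝ) - 2 * Real.sqrt N| = v at *
      calc u ≤ u * (u * v) := le_mul_of_one_le_right h1.le h3
        _ = u ^ 2 * v := by ring
        _ ≤ _ := by gcongr
    · generalize |(F.b : ℝ) + 2 * Real.sqrt N| = u at *
      generalize |(F.b : ℝ) - 2 * Real.sqrt N| = v at *
      calc v ≤ v * (u * v) := le_mul_of_one_le_right h2.le h3
        _ = v ^ 2 * u := by ring
        _ ≤ _ := by gcongr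

/-- The sum of the absolute values of the distances travelled by `k` applications of `ρ`. -/
noncomputable def pathCost (F : BQForm) (k : ℕ) : ℝ :=
  ∑ i ∈ Finset.range k, |stepDist (BQForm.rho^[i] F)|

theorem pathCost_succ (F : BQForm) (k : ℕ) :
    pathCost F (k + 1) = |stepDist F| + pathCost (BQForm.rho F) k := by
  rw [pathCost, Finset.sum_range_succ', add_comm]
  rfl

/-- `pathDist` can fail to be monotone, since `stepDist` may be negative at unreduced forms. With
absolute values, a bound for any k that reaches a reduced form also covers the least one. -/
theorem pathCost_mono (F : BQForm) {r k : ℕ} (h : r ≤ k) : pathCost F r ≤ pathCost F k :=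
  Finset.sum_le_sum_of_subset_of_nonneg (Finset.range_subset_range.2 h) fun _ _ _ => abs_nonneg _

theorem abs_pathDist_le_pathCost (F : BQForm) (k : ℕ) : |pathDist F k| ≤ pathCost F k :=
  Finset.abs_sum_le_sum_abs _ _

theorem IsRep.isReduced_iff (h : F.IsRep N γ) :
    F.IsReduced ↔ abs (2 * Real.sqrt N - 2 * |(F.a : ℝ)|) < F.b ∧ (F.b : ℝ) < 2 * Real.sqrt N := by
  rw [IsReduced, h.sqrt_disc]

theorem IsRep.rho_isReduced (hN : ¬ IsSquare N) (h : F.IsRep N γ)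
    (hc : |(F.c : ℝ)| ≤ Real.sqrt N) : (BQForm.rho F).IsReduced := by
  obtain ⟨η, h1, -⟩ := h.rho hN
  obtain ⟨-, -, h2⟩ := h.rRes_spec hN
  have hs := one_lt_sqrt_of_not_isSquare hN
  obtain ⟨h3, h4⟩ := h2 (by linarith)
  rw [h1.isReduced_iff]
  refine ⟨?_, h4⟩
  rw [show (BQForm.rho F).a = F.c from rfl, abs_of_nonneg (by linarith)]
  exact h3

/-- If |c| ≤ √N, one step suffices. Otherwise the new b satisfies |b| < 2√N, so 4|c||c'| ≤ 4N and
|c'| ≤ √N, and a second step suffices. -/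
theorem IsRep.exists_reduced_of_small (hN : ¬ IsSquare N) (h : F.IsRep N γ)
    (hc : |(F.c : ℝ)| < 2 * Real.sqrt N) :
    ∃ k, (BQForm.rho^[k] F).IsReduced ∧ pathCost F k ≤ 2 * Real.log (6 * Real.sqrt N) := by
  have hL := log_six_sqrt_pos hN
  have hF := h.abs_stepDist_le hN
  have hs := one_lt_sqrt_of_not_isSquare hN
  rcases le_or_gt |(F.c : ℝ)| (Real.sqrt N) with h1 | h1
  · refine ⟨1, h.rho_isReduced hN h1, ?_⟩
    rw [pathCost_succ, pathCost, Finset.sum_range_zero]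
    linarith
  · obtain ⟨η, h2, -⟩ := h.rho hN
    have hF' := h2.abs_stepDist_le hN
    obtain ⟨h3, h4⟩ := (h.rRes_spec hN).2.2 hc
    refine ⟨2, h2.rho_isReduced hN ?_, ?_⟩
    · have h5 := h2.sq_sub
      rw [show (BQForm.rho F).a = F.c from rfl] at h5
      have h6 : 4 * |(F.c : ℝ)| * |((BQForm.rho F).c : ℝ)| ≤ 4 * Real.sqrt N ^ 2 := by
        have : |4 * (F.c : ℝ) * (BQForm.rho F).c| ≤ 4 * Real.sqrt N ^ 2 := by
          rw [abs_le]
          constructor <;> nlinarith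
        rwa [abs_mul, abs_mul, abs_of_pos (by norm_num : (0 : ℝ) < 4)] at this
      nlinarith [abs_nonneg ((BQForm.rho F).c : ℝ)]
    · rw [pathCost_succ, pathCost_succ, pathCost, Finset.sum_range_zero]
      linarith

theorem IsRep.abs_rho_c_le (hN : ¬ IsSquare N) (h : F.IsRep N γ)
    (hc : 2 * Real.sqrt N < |(F.c : ℝ)|) : 4 * |((BQForm.rho F).c : ℝ)| ≤ |(F.c : ℝ)| := by
  obtain ⟨η, h2, -⟩ := h.rho hN
  have hs := one_lt_sqrt_of_not_isSquare hN
  have h3 := (h.rRes_spec hN).2.1 hc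
  have h5 := h2.sq_sub
  rw [show (BQForm.rho F).a = F.c from rfl] at h5
  have h6 : 4 * |(F.c : ℝ)| * |((BQForm.rho F).c : ℝ)| ≤ |(F.c : ℝ)| ^ 2 := by
    have : |4 * (F.c : ℝ) * (BQForm.rho F).c| ≤ |(F.c : ℝ)| ^ 2 := by
      have h7 : ((BQForm.rho F).b : ℝ) ^ 2 ≤ |(F.c : ℝ)| ^ 2 := by
        rw [← sq_abs ((BQForm.rho F).b : ℝ)]
        gcongr
      rw [abs_le]
      constructor <;> nlinarith
    rwa [abs_mul, abs_mul, abs_of_pos (by norm_num : (0 : ℝ) < 4)] at this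
  have h8 : 0 < |(F.c : ℝ)| := by linarith
  nlinarith

/-- Each step divides |c| by at least 4 and costs at most ½ ln 3 < ½ ln 4, so the cost telescopes
against the potential ½ ln |c|. The number n merely bounds |c| for the induction. -/
theorem IsRep.exists_reduced_of_normalized (hN : ¬ IsSquare N) (n : ℕ) :
    ∀ {F : BQForm} {γ : ℤ√(N : ℤ)}, F.IsRep N γ → F.c.natAbs ≤ n →
      |(F.b : ℝ)| ≤ |(F.a : ℝ)| → 2 * Real.sqrt N < |(F.a : ℝ)| →
      2 * Real.sqrt N < |(F.c : ℝ)| →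
    ∃ k, (BQForm.rho^[k] F).IsReduced ∧
      pathCost F k ≤ 2 * Real.log (6 * Real.sqrt N) +
        1 / 2 * Real.log (2 * |(F.c : ℝ)| / Real.sqrt N) := by
  have hs := one_lt_sqrt_of_not_isSquare hN
  have hs0 : 0 < Real.sqrt N := by linarith
  induction n with
  | zero =>
    intro F γ h hn hb ha hc
    exact absurd (Int.natAbs_eq_zero.1 (Nat.le_zero.1 hn)) (h.c_ne_zero hN)
  | succ n ih =>
    intro F γ h hn hb ha hc
    have hac : 4 * Real.sqrt N ^ 2 < |(F.a : ℝ)| * |(F.c : ℝ)| := by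
      nlinarith
    -- Otherwise |b² − 4N| ≤ 12N, whereas 4|ac| > 16N.
    have hb4 : 4 * Real.sqrt N ≤ |(F.b : ℝ)| := by
      by_contra hlt
      rw [not_le] at hlt
      have h1 : 4 * |(F.a : ℝ)| * |(F.c : ℝ)| ≤ 12 * Real.sqrt N ^ 2 := by
        rw [← h.abs_mul_eq, ← abs_mul, abs_le]
        rw [abs_lt] at hlt
        constructor <;> nlinarith [sq_nonneg (F.b : ℝ)]
      nlinarith
    have hstep := h.abs_stepDist_le_of_large hN hb4
    have h34 : Real.log 3 ≤ Real.log 4 := Real.log_le_log (by norm_num) (by norm_num)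
    obtain ⟨η, h2, -⟩ := h.rho hN
    have hc' := h.abs_rho_c_le hN hc
    have hb' := (h.rRes_spec hN).2.1 hc
    have hpos := h2.one_le_abs_c hN
    have hrel : ∀ x : ℝ, 0 < x → 4 * x ≤ 2 * |(F.c : ℝ)| / Real.sqrt N →
        Real.log 4 + Real.log x ≤ Real.log (2 * |(F.c : ℝ)| / Real.sqrt N) := by
      intro x hx hle
      rw [← Real.log_mul (by norm_num) hx.ne']
      exact Real.log_le_log (by positivity) hle
    rcases lt_or_gt_of_ne (two_mul_sqrt_ne hN (BQForm.rho F).c) with hlt | hgt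
    · obtain ⟨k, hk, hcost⟩ := ih h2 (by
        have h9 : 4 * |(BQForm.rho F).c| ≤ |F.c| := by exact_mod_cast hc'
        have h10 : 1 ≤ |(BQForm.rho F).c| := by exact_mod_cast hpos
        rw [Int.abs_eq_natAbs] at h9 h10
        rw [Int.abs_eq_natAbs] at h9
        omega) hb' hc hlt
      refine ⟨k + 1, hk, ?_⟩
      rw [pathCost_succ]
      have := hrel (2 * |((BQForm.rho F).c : ℝ)| / Real.sqrt N) (by positivity) (by
        rw [← mul_div_assoc]
        exact div_le_div_of_nonneg_right (by linarith) hs0.le)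
      linarith
    · obtain ⟨k, hk, hcost⟩ := h2.exists_reduced_of_small hN hgt
      refine ⟨k + 1, hk, ?_⟩
      rw [pathCost_succ]
      have := hrel 1 one_pos (by
        rw [le_div_iff₀ hs0]
        linarith)
      rw [Real.log_one] at this
      linarith

/-- A bound for the distance travelled by the reduction steps of a giant step. -/
noncomputable def giantStepBound (N : ℕ) : ℝ :=
  3 * Real.log (6 * Real.sqrt N) + 1 / 2 * Real.log (16 * Real.sqrt N)

/-- The first step normalizes the form and leaves |c'| ≤ 8N, so the potential is at most ½ ln(16√N).
That step and the final two account for 3 ln(6√N) in `giantStepBound`. -/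
theorem IsRep.exists_reduced (hN : ¬ IsSquare N) (h : F.IsRep N γ)
    (ha : |(F.a : ℝ)| ≤ 4 * Real.sqrt N ^ 2) :
    ∃ k, (BQForm.rho^[k] F).IsReduced ∧ pathCost F k ≤ giantStepBound N := by
  have hL := log_six_sqrt_pos hN
  have hs := one_lt_sqrt_of_not_isSquare hN
  have hs0 : 0 < Real.sqrt N := by linarith
  have h16 : 0 < Real.log (16 * Real.sqrt N) := Real.log_pos (by linarith)
  have hE : 3 * Real.log (6 * Real.sqrt N) ≤ giantStepBound N := by
    rw [giantStepBound]; linarith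
  rcases lt_or_gt_of_ne (two_mul_sqrt_ne hN F.c) with hlt | hgt
  · obtain ⟨η, h2, -⟩ := h.rho hN
    have hstep := h.abs_stepDist_le hN
    obtain ⟨hdvd, hb', -⟩ := h.rRes_spec hN
    replace hb' := hb' hlt
    have hc' : |((BQForm.rho F).c : ℝ)| ≤ 8 * Real.sqrt N ^ 2 := by
      have e2 := h2.sq_sub
      rw [show (BQForm.rho F).a = F.c from rfl] at e2
      rcases lt_or_ge |(F.b : ℝ)| |(F.c : ℝ)| with hb | hb
      -- Here |r + b| < 2|c| forces r = −b, so the step only interchanges a and c.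
      · have hb0 : (BQForm.rho F).b + F.b = 0 := by
          apply Int.eq_zero_of_abs_lt_dvd ((abs_dvd _ _).2 hdvd)
          have : |((BQForm.rho F).b : ℝ) + F.b| < 2 * |(F.c : ℝ)| :=
            (abs_add_le _ _).trans_lt (by linarith)
          have : |(BQForm.rho F).b + F.b| < 2 * |F.c| := by exact_mod_cast this
          rwa [abs_mul, abs_two]
        have hb1 : ((BQForm.rho F).b : ℝ) = -F.b := by
          have : (BQForm.rho F).b = -F.b := by linarith
          exact_mod_cast this
        rw [hb1] at e2
        have e1 := h.sq_sub
        have hc0 : (F.c : ℝ) ≠ 0 := by exact_mod_cast h.c_ne_zero hN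
        have : ((BQForm.rho F).c : ℝ) = F.a := by
          apply mul_left_cancel₀ hc0
          linarith
        rw [this]
        nlinarith
      -- Here |c| ≤ |b|, and b² ≤ 4N + 4|a||c| gives |b| ≤ 2√N + 4|a|; then |c'| ≤ |c|/4.
      · have h3 := h.abs_rho_c_le hN hlt
        have h4 : |(F.b : ℝ)| ^ 2 ≤ 4 * Real.sqrt N ^ 2 + 4 * |(F.a : ℝ)| * |(F.c : ℝ)| := by
          have : 4 * (F.a : ℝ) * F.c ≤ |4 * (F.a : ℝ) * F.c| := le_abs_self _
          rw [abs_mul, abs_mul, abs_of_pos (by norm_num : (0 : ℝ) < 4)] at this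
          rw [sq_abs]
          linarith [h.sq_sub]
        have h5 : |(F.b : ℝ)| * |(F.b : ℝ)| ≤
            (2 * Real.sqrt N + 4 * |(F.a : ℝ)|) * |(F.b : ℝ)| := by
          have : 2 * Real.sqrt N * (2 * Real.sqrt N) ≤ 2 * Real.sqrt N * |(F.b : ℝ)| := by
            gcongr; linarith
          have : 4 * |(F.a : ℝ)| * |(F.c : ℝ)| ≤ 4 * |(F.a : ℝ)| * |(F.b : ℝ)| := by gcongr
          nlinarith
        have h6 := le_of_mul_le_mul_right h5 (by linarith)
        nlinarith
    rcases lt_or_gt_of_ne (two_mul_sqrt_ne hN (BQForm.rho F).c) with hlt' | hgt'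
    · obtain ⟨k, hk, hcost⟩ := exists_reduced_of_normalized hN _ h2 le_rfl hb' hlt hlt'
      refine ⟨k + 1, hk, ?_⟩
      rw [pathCost_succ, giantStepBound]
      have : Real.log (2 * |((BQForm.rho F).c : ℝ)| / Real.sqrt N) ≤
          Real.log (16 * Real.sqrt N) := by
        apply Real.log_le_log
        · have := h2.one_le_abs_c hN
          positivity
        · rw [div_le_iff₀ hs0]
          nlinarith
      linarith
    · obtain ⟨k, hk, hcost⟩ := h2.exists_reduced_of_small hN hgt'
      refine ⟨k + 1, hk, ?_⟩
      rw [pathCost_succ]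
      linarith
  · obtain ⟨k, hk, hcost⟩ := h.exists_reduced_of_small hN hgt
    exact ⟨k, hk, by linarith⟩

/-! ### Giant steps -/

/-- `F` is a reduced principal form, at distance `x` (up to multiples of the regulator). -/
def IsPrincipalAt (N : ℕ) (F : BQForm) (x : ℝ) : Prop :=
  F.IsReduced ∧ ∃ γ, F.IsRep N γ ∧ logRatio γ = x

theorem IsRep.abs_a_lt (h : F.IsRep N γ) (hr : F.IsReduced) : |(F.a : ℝ)| < 2 * Real.sqrt N := by
  obtain ⟨h1, h2⟩ := h.isReduced_iff.1 hr
  rw [abs_lt] at h1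
  linarith

theorem composition_exists_reduced (hN : ¬ IsSquare N) {F G K : BQForm} {x y : ℝ}
    (hF : F.IsPrincipalAt N x) (hG : G.IsPrincipalAt N y) (hK : IsComposition F G K) :
    ∃ γ, K.IsRep N γ ∧ logRatio γ = x + y ∧
      ∃ k, (BQForm.rho^[k] K).IsReduced ∧ pathCost K k ≤ giantStepBound N := by
  obtain ⟨hF, γ₁, h1, rfl⟩ := hF
  obtain ⟨hG, γ₂, h2, rfl⟩ := hG
  obtain ⟨ha, γ, h3, h4⟩ := h1.composition hN h2 hK
  refine ⟨γ, h3, h4, h3.exists_reduced hN ?_⟩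
  have ha1 := h1.abs_a_lt hF
  have ha2 := h2.abs_a_lt hG
  have : |(K.a : ℝ)| ≤ |(F.a : ℝ) * G.a| := by exact_mod_cast ha
  rw [abs_mul] at this
  refine this.trans ?_
  calc |(F.a : ℝ)| * |(G.a : ℝ)| ≤ (2 * Real.sqrt N) * (2 * Real.sqrt N) := by gcongr
    _ = _ := by ring

theorem IsGiantStep.isPrincipalAt (hN : ¬ IsSquare N) {F G H : BQForm} {x y e : ℝ}
    (hF : F.IsPrincipalAt N x) (hG : G.IsPrincipalAt N y) (h : IsGiantStep F G H e) :
    H.IsPrincipalAt N (x + y + e) ∧ |e| ≤ giantStepBound N := by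
  obtain ⟨K, r, hK, hr, rfl, rfl⟩ := h
  obtain ⟨γ, h1, h2, k, hk, hcost⟩ := composition_exists_reduced hN hF hG hK
  obtain ⟨η, h3, h4⟩ := h1.iterate_rho hN r
  refine ⟨⟨hr.1, η, h3, by rw [h4, h2]⟩, ?_⟩
  exact (abs_pathDist_le_pathCost _ _).trans ((pathCost_mono _ (hr.2 hk)).trans hcost)

theorem IsPrincipalAt.disc_eq {x : ℝ} (h : F.IsPrincipalAt N x) : F.disc = 4 * N := by
  obtain ⟨-, γ, h, -⟩ := h
  exact h.disc_eq

theorem exists_isGiantStep (hN : ¬ IsSquare N) {F G : BQForm} {x y : ℝ}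
    (hF : F.IsPrincipalAt N x) (hG : G.IsPrincipalAt N y) : ∃ H e, IsGiantStep F G H e := by
  obtain ⟨K, hK⟩ := exists_isComposition (F := F) (G := G) (by rw [hF.disc_eq, hG.disc_eq])
  obtain ⟨γ, -, -, k, hk, -⟩ := composition_exists_reduced hN hF hG hK
  have hne : {k : ℕ | (BQForm.rho^[k] K).IsReduced}.Nonempty := ⟨k, hk⟩
  exact ⟨_, _, K, _, hK, ⟨Nat.sInf_mem hne, fun _ h => Nat.sInf_le h⟩, rfl, rfl⟩

end BQForm

/-! ### The continued fraction expansion of `√N` -/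

theorem cfP_succ (N m : ℕ) : cfP N (m + 1) = cfA N m * cfQ N m - cfP N m := rfl

theorem cfQ_succ (N m : ℕ) : cfQ N (m + 1) = ((N : ℤ) - cfP N (m + 1) ^ 2) / cfQ N m := rfl

theorem sqrt_ne_intCast {N : ℕ} (hN : ¬ IsSquare N) (z : ℤ) : Real.sqrt N ≠ z := by
  intro h
  have h1 : Real.sqrt N ^ 2 = (z : ℝ) ^ 2 := by rw [h]
  rw [Real.sq_sqrt (Nat.cast_nonneg N)] at h1
  have : (N : ℤ) = z * z := by
    rw [← sq]
    exact_mod_cast h1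
  exact ne_mul_self_of_not_isSquare hN z this

theorem cfP_succ_bounds {N : ℕ} (hN : ¬ IsSquare N) {m : ℕ} (hQ : 0 < cfQ N m)
    (hPQ : (cfQ N m : ℝ) < cfP N m + Real.sqrt N) :
    (cfP N (m + 1) : ℝ) < Real.sqrt N ∧ Real.sqrt N - cfQ N m < cfP N (m + 1) ∧ 1 ≤ cfA N m := by
  have hQ' : (0 : ℝ) < cfQ N m := by exact_mod_cast hQ
  have h1 : (cfA N m : ℝ) ≤ ((cfP N m : ℝ) + Real.sqrt N) / (cfQ N m : ℝ) := Int.floor_le _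
  have h2 : ((cfP N m : ℝ) + Real.sqrt N) / (cfQ N m : ℝ) < cfA N m + 1 := Int.lt_floor_add_one _
  rw [le_div_iff₀ hQ'] at h1
  rw [div_lt_iff₀ hQ'] at h2
  have h3 := sqrt_ne_intCast hN (cfP N (m + 1))
  have h4 : (cfP N (m + 1) : ℝ) = cfA N m * cfQ N m - cfP N m := by
    rw [cfP_succ]; push_cast; ring
  refine ⟨lt_of_le_of_ne (by linarith) h3.symm, by linarith, ?_⟩
  rw [cfA, Int.le_floor, Int.cast_one, one_le_div hQ']
  exact hPQ.le

theorem cf_step {N : ℕ} (hN : ¬ IsSquare N) {m : ℕ} (hQ : 0 < cfQ N m)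
    (hP : (cfP N m : ℝ) < Real.sqrt N) (hPQ : (cfQ N m : ℝ) < cfP N m + Real.sqrt N)
    (hd : cfQ N m ∣ N - cfP N m ^ 2) :
    cfQ N m * cfQ N (m + 1) = N - cfP N (m + 1) ^ 2 ∧ 0 < cfQ N (m + 1) ∧
      (cfQ N m : ℝ) - Real.sqrt N < cfP N (m + 1) ∧
      (cfQ N (m + 1) : ℝ) < cfP N (m + 1) + Real.sqrt N ∧
      Real.sqrt N - cfP N (m + 1) < cfQ N (m + 1) := by
  have hQ' : (0 : ℝ) < cfQ N m := by exact_mod_cast hQ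
  obtain ⟨h1, h2, h3⟩ := cfP_succ_bounds hN hQ hPQ
  have hmul : cfQ N m * cfQ N (m + 1) = N - cfP N (m + 1) ^ 2 := by
    rw [cfQ_succ]
    refine Int.mul_ediv_cancel' ?_
    have : (N : ℤ) - cfP N (m + 1) ^ 2 =
        (N - cfP N m ^ 2) - cfQ N m * (cfA N m * (cfA N m * cfQ N m - 2 * cfP N m)) := by
      rw [cfP_succ]; ring
    rw [this]
    exact dvd_sub hd (dvd_mul_right _ _)
  have h4 : (cfQ N m : ℝ) - Real.sqrt N < cfP N (m + 1) := by
    have : cfQ N m - cfP N m ≤ cfP N (m + 1) := by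
      rw [cfP_succ]
      nlinarith
    have : (cfQ N m : ℝ) - cfP N m ≤ cfP N (m + 1) := by exact_mod_cast this
    linarith
  have hmul' : (cfQ N m : ℝ) * cfQ N (m + 1) =
      (Real.sqrt N - cfP N (m + 1)) * (Real.sqrt N + cfP N (m + 1)) := by
    have : (cfQ N m : ℝ) * cfQ N (m + 1) = N - cfP N (m + 1) ^ 2 := by exact_mod_cast hmul
    rw [this, ← Real.sq_sqrt (Nat.cast_nonneg N)]
    simp only [Real.sqrt_sq (Real.sqrt_nonneg _)]
    ring
  have h5 : (0 : ℝ) < cfQ N (m + 1) := by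
    have : 0 < (cfQ N m : ℝ) * cfQ N (m + 1) := by
      rw [hmul']
      apply mul_pos <;> linarith
    exact pos_of_mul_pos_right this hQ'.le
  refine ⟨hmul, by exact_mod_cast h5, h4, ?_, ?_⟩
  · have : (cfQ N m : ℝ) * cfQ N (m + 1) < cfQ N m * (cfP N (m + 1) + Real.sqrt N) := by
      rw [hmul']
      nlinarith
    exact lt_of_mul_lt_mul_left this hQ'.le
  · have : (cfQ N m : ℝ) * (Real.sqrt N - cfP N (m + 1)) < cfQ N m * cfQ N (m + 1) := by
      rw [hmul']
      nlinarith
    exact lt_of_mul_lt_mul_left this hQ'.le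

/-- The bound √N − P_m < Q_m is left out because it fails at (P_0, Q_0) = (0, 1); `cf_step` supplies
it from index 1 on. -/
theorem cf_invariant {N : ℕ} (hN : ¬ IsSquare N) (m : ℕ) :
    0 < cfQ N m ∧ (cfP N m : ℝ) < Real.sqrt N ∧ (cfQ N m : ℝ) < cfP N m + Real.sqrt N ∧
      cfQ N m ∣ N - cfP N m ^ 2 := by
  have hs := one_lt_sqrt_of_not_isSquare hN
  induction m with
  | zero =>
    have hP : cfP N 0 = 0 := rfl
    have hQ : cfQ N 0 = 1 := rfl
    rw [hP, hQ]
    refine ⟨one_pos, ?_, ?_, one_dvd _⟩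
    · simp only [Int.cast_zero]; linarith
    · simp only [Int.cast_zero, Int.cast_one]; linarith
  | succ m ih =>
    obtain ⟨h1, h2, h3, h4⟩ := ih
    obtain ⟨k1, k2, k3, k4, k5⟩ := cf_step hN h1 h2 h3 h4
    exact ⟨k2, (cfP_succ_bounds hN h1 h3).1, k4, ⟨cfQ N m, by rw [← k1]; ring⟩⟩

section

variable {N : ℕ} (hN : ¬ IsSquare N) (m : ℕ)
include hN

theorem cfQ_pos : 0 < cfQ N m := (cf_invariant hN m).1

theorem cfQ_lt : (cfQ N m : ℝ) < cfP N m + Real.sqrt N := (cf_invariant hN m).2.2.1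

theorem cfP_lt : (cfP N m : ℝ) < Real.sqrt N := (cf_invariant hN m).2.1

theorem sqrt_sub_cfQ_lt : Real.sqrt N - cfQ N m < cfP N (m + 1) :=
  (cfP_succ_bounds hN (cfQ_pos hN m) (cfQ_lt hN m)).2.1

theorem one_le_cfA : 1 ≤ cfA N m :=
  (cfP_succ_bounds hN (cfQ_pos hN m) (cfQ_lt hN m)).2.2

theorem cf_step_all :
    cfQ N m * cfQ N (m + 1) = N - cfP N (m + 1) ^ 2 ∧ 0 < cfQ N (m + 1) ∧
      (cfQ N m : ℝ) - Real.sqrt N < cfP N (m + 1) ∧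
      (cfQ N (m + 1) : ℝ) < cfP N (m + 1) + Real.sqrt N ∧
      Real.sqrt N - cfP N (m + 1) < cfQ N (m + 1) :=
  let h := cf_invariant hN m
  cf_step hN h.1 h.2.1 h.2.2.1 h.2.2.2

theorem cfQ_mul_cfQ_succ : cfQ N m * cfQ N (m + 1) = N - cfP N (m + 1) ^ 2 :=
  (cf_step_all hN m).1

theorem cfP_succ_pos : 0 < cfP N (m + 1) := by
  have h1 := sqrt_sub_cfQ_lt hN m
  have h2 := (cf_step_all hN m).2.2.1
  have : (0 : ℝ) < cfP N (m + 1) := by linarith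
  exact_mod_cast this

theorem sqrt_sub_cfQ_succ_lt : Real.sqrt N - cfQ N (m + 1) < cfP N (m + 1) := by
  linarith [(cf_step_all hN m).2.2.2.2]

theorem cfQ_lt_two_mul_sqrt : (cfQ N m : ℝ) < 2 * Real.sqrt N := by
  linarith [cfQ_lt hN m, cfP_lt hN m]

end

/-! ### The generators of the principal cycle -/

/-- The numerators and denominators of the convergents, as elements `p_{m-1} + q_{m-1} √N`. -/
noncomputable def cfGen (N : ℕ) : ℕ → ℤ√(N : ℤ)
  | 0 => 1
  | 1 => ⟨cfA N 0, 1⟩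
  | m + 2 => cfA N (m + 1) * cfGen N (m + 1) + cfGen N m

/-- Consecutive convergents have determinant (−1)^m, so they form a basis whose orientation
alternates; `cfGen_isRep` corrects this by the sign (−1)^m on the second vector. -/
theorem cfGen_basis {N : ℕ} (hN : ¬ IsSquare N) (m : ℕ) :
    (cfGen N m).norm = (-1) ^ m * cfQ N m ∧
      star (cfGen N m) * cfGen N (m + 1) = (-1) ^ m * ⟨cfP N (m + 1), 1⟩ := by
  induction m with
  | zero =>
    have hP : cfP N 0 = 0 := rfl
    have hQ : cfQ N 0 = 1 := rfl
    refine ⟨by simp [cfGen, hQ], ?_⟩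
    simp [cfGen, cfP_succ, hP, hQ]
  | succ m ih =>
    obtain ⟨h1, h2⟩ := ih
    have h3 : (cfGen N (m + 1)).norm = (-1) ^ (m + 1) * cfQ N (m + 1) := by
      have h4 := congrArg Zsqrtd.norm h2
      rw [Zsqrtd.norm_mul, Zsqrtd.norm_conj, h1] at h4
      have h5 : (((-1) ^ m * ⟨cfP N (m + 1), 1⟩ : ℤ√(N : ℤ))).norm = cfP N (m + 1) ^ 2 - N := by
        rw [Zsqrtd.norm_mul]
        rcases neg_one_pow_eq_or (ℤ√(N : ℤ)) m with h | h <;> rw [h] <;>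
          (simp [Zsqrtd.norm_def]; ring)
      rw [h5] at h4
      have h6 := cfQ_mul_cfQ_succ hN m
      apply mul_left_cancel₀ (cfQ_pos hN m).ne'
      rcases neg_one_pow_eq_or ℤ m with h | h <;> rw [pow_succ, h] <;> rw [h] at h4 <;> linarith
    refine ⟨h3, ?_⟩
    have h7 : star (cfGen N (m + 1)) * cfGen N (m + 1 + 1) =
        cfA N (m + 1) * (cfGen N (m + 1) * star (cfGen N (m + 1))) +
          star (star (cfGen N m) * cfGen N (m + 1)) := by
      rw [star_mul', star_star, cfGen]
      ring
    rw [h7, h2, ← Zsqrtd.norm_eq_mul_conj, h3, cfP_succ N (m + 1)]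
    rcases neg_one_pow_eq_or (ℤ√(N : ℤ)) m with h | h <;>
    rcases neg_one_pow_eq_or ℤ m with h' | h' <;> rw [pow_succ, pow_succ, h, h'] <;>
    -- The sign (−1)^m is split separately in ℤ and in `ℤ[√N]`; the two mismatched cases would give
    -- 1 = −1.
    first
    | (exfalso
       have e := congrArg (Int.cast : ℤ → ℤ√(N : ℤ)) h'
       push_cast at e
       rw [h] at e
       have := congrArg Zsqrtd.re e
       simp at this
       done)
    | (ext <;> simp; ring)

theorem cfGen_isRep {N : ℕ} (hN : ¬ IsSquare N) (m : ℕ) :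
    (upsilon N m).IsRep N (cfGen N m) := by
  obtain ⟨h1, h2⟩ := cfGen_basis hN m
  obtain ⟨h3, -⟩ := cfGen_basis hN (m + 1)
  refine ⟨(-1) ^ m * cfGen N (m + 1), cfP N (m + 1), ?_, ?_⟩
  · rw [mul_left_comm, h2, ← mul_assoc, ← mul_pow]
    simp
  · rw [Zsqrtd.norm_mul, h1, h3, upsilon]
    rcases neg_one_pow_eq_or (ℤ√(N : ℤ)) m with h | h <;> rw [h] <;> simp

theorem cfGen_growth {N : ℕ} (hN : ¬ IsSquare N) (m : ℕ) :
    1 ≤ sqrtEmbed N (cfGen N m) ∧ (m : ℝ) + 1 ≤ sqrtEmbed N (cfGen N (m + 1)) ∧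
      sqrtEmbed N (cfGen N m) < sqrtEmbed N (cfGen N (m + 1)) := by
  have hs := one_lt_sqrt_of_not_isSquare hN
  have hA : ∀ m, (1 : ℝ) ≤ cfA N m := fun m => by exact_mod_cast one_le_cfA hN m
  induction m with
  | zero =>
    have h0 : sqrtEmbed N (cfGen N 0) = 1 := by simp [cfGen]
    have h1 : sqrtEmbed N (cfGen N (0 + 1)) = cfA N 0 + Real.sqrt N := by
      simp [cfGen, sqrtEmbed_apply]
    rw [h0, h1]
    push_cast
    refine ⟨le_rfl, ?_, ?_⟩ <;> linarith [hA 0]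
  | succ m ih =>
    obtain ⟨h1, h2, h3⟩ := ih
    have h4 : sqrtEmbed N (cfGen N (m + 1 + 1)) =
        cfA N (m + 1) * sqrtEmbed N (cfGen N (m + 1)) + sqrtEmbed N (cfGen N m) := by
      rw [cfGen, map_add, map_mul, map_intCast]
    have h5 : sqrtEmbed N (cfGen N (m + 1)) ≤
        cfA N (m + 1) * sqrtEmbed N (cfGen N (m + 1)) :=
      le_mul_of_one_le_left (by linarith) (hA _)
    push_cast
    refine ⟨by linarith, ?_, ?_⟩ <;> linarith

theorem upsilon_isReduced {N : ℕ} (hN : ¬ IsSquare N) (m : ℕ) : (upsilon N m).IsReduced := by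
  rw [(cfGen_isRep hN m).isReduced_iff]
  have h1 := cfQ_pos hN m
  have h2 := sqrt_sub_cfQ_lt hN m
  have h3 := (cf_step_all hN m).2.2.1
  have h4 := cfP_lt hN (m + 1)
  have h5 : |((upsilon N m).a : ℝ)| = cfQ N m := by
    have : (0 : ℝ) < cfQ N m := by exact_mod_cast h1
    simp [upsilon, abs_mul, abs_of_pos this]
  rw [h5, upsilon]
  push_cast
  refine ⟨?_, by linarith⟩
  rw [abs_lt]
  constructor <;> linarith

/-- P_{m+2} = a_{m+1}Q_{m+1} − P_{m+1} gives the congruence for r, and √N − Q_{m+1} < P_{m+2} < √N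
gives its window. As Q_{m+1} < 2√N, only the second branch of the definition of r occurs. -/
theorem rho_upsilon {N : ℕ} (hN : ¬ IsSquare N) (m : ℕ) :
    BQForm.rho (upsilon N m) = upsilon N (m + 1) := by
  have hrep := cfGen_isRep hN m
  have hD := hrep.disc_eq
  have hs := one_lt_sqrt_of_not_isSquare hN
  have hN0 : 0 < N := by
    rcases Nat.eq_zero_or_pos N with h | h
    · exact absurd ⟨0, by simp [h]⟩ hN
    · exact h
  have hQ := cfQ_pos hN (m + 1)
  have hQ' : (0 : ℝ) < cfQ N (m + 1) := by exact_mod_cast hQ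
  have hc : |((upsilon N m).c : ℝ)| = cfQ N (m + 1) := by
    simp [upsilon, abs_mul, abs_of_pos hQ']
  have hb : 2 * cfP N (m + 2) =
      BQForm.rRes (upsilon N m).disc (upsilon N m).b (upsilon N m).c := by
    rw [BQForm.rRes_spec (by rw [hD]; omega) (by rw [hD]; exact not_isSquare_four_mul hN)
      (hrep.c_ne_zero hN), hrep.sqrt_disc, hc]
    refine ⟨?_, fun h => ?_, fun _ => ?_⟩
    · have : 2 * cfP N (m + 2) + (upsilon N m).b = 2 * cfQ N (m + 1) * cfA N (m + 1) := by
        rw [cfP_succ, upsilon]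
        ring
      rw [this, upsilon]
      simp only
      refine Dvd.dvd.mul_right (mul_dvd_mul_left 2 ?_) _
      rcases neg_one_pow_eq_or ℤ (m + 1) with h | h <;> rw [h] <;> simp
    · linarith [cfQ_lt_two_mul_sqrt hN (m + 1)]
    · have h1 := sqrt_sub_cfQ_lt hN (m + 1)
      have h2 := cfP_lt hN (m + 2)
      push_cast
      constructor <;> linarith
  have hmul := cfQ_mul_cfQ_succ hN (m + 1)
  ext
  · rfl
  · exact hb.symm
  · change (BQForm.rRes (upsilon N m).disc (upsilon N m).b (upsilon N m).c ^ 2 -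
      (upsilon N m).disc) / (4 * (upsilon N m).c) = _
    rw [← hb, hD]
    simp only [upsilon]
    rw [show (2 * cfP N (m + 2)) ^ 2 - 4 * (N : ℤ) =
      4 * ((-1) ^ (m + 1) * cfQ N (m + 1)) * ((-1) ^ (m + 1 + 1) * cfQ N (m + 1 + 1)) by
        rw [pow_succ (-1 : ℤ) (m + 1)]
        rcases neg_one_pow_eq_or ℤ (m + 1) with h | h <;> rw [h] <;> linarith]
    refine Int.mul_ediv_cancel_left _ ?_
    rcases neg_one_pow_eq_or ℤ (m + 1) with h | h <;> rw [h] <;> omega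

theorem iterate_rho_upsilon {N : ℕ} (hN : ¬ IsSquare N) (k m : ℕ) :
    BQForm.rho^[k] (upsilon N m) = upsilon N (m + k) := by
  induction k with
  | zero => rfl
  | succ k ih => rw [Function.iterate_succ_apply', ih, rho_upsilon hN]; rfl

/-- The distance from `Υ_0` to `Υ_m` along the principal cycle. -/
theorem pathDist_upsilon {N : ℕ} (hN : ¬ IsSquare N) (m : ℕ) :
    (upsilon N 0).pathDist m = ∑ i ∈ Finset.range m, (upsilon N i).stepDist := by
  rw [BQForm.pathDist]
  refine Finset.sum_congr rfl fun i _ => ?_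
  rw [iterate_rho_upsilon hN, zero_add]

theorem pathDist_upsilon_succ {N : ℕ} (hN : ¬ IsSquare N) (m : ℕ) :
    (upsilon N 0).pathDist (m + 1) = (upsilon N 0).pathDist m + (upsilon N m).stepDist := by
  rw [pathDist_upsilon hN, pathDist_upsilon hN, Finset.sum_range_succ]

theorem logRatio_cfGen {N : ℕ} (hN : ¬ IsSquare N) (m : ℕ) :
    logRatio (cfGen N m) = (upsilon N 0).pathDist m := by
  induction m with
  | zero => simp [cfGen, logRatio_one, BQForm.pathDist]
  | succ m ih =>
    rw [pathDist_upsilon_succ hN, ← ih]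
    obtain ⟨h1, h2⟩ := cfGen_basis hN m
    obtain ⟨h3, -⟩ := cfGen_basis hN (m + 1)
    have e : star (cfGen N m) * ((-1) ^ m * cfGen N (m + 1)) = ⟨cfP N (m + 1), 1⟩ := by
      rw [mul_left_comm, h2, ← mul_assoc, ← mul_pow]
      simp
    have h4 := BQForm.logRatio_of_basis hN e
    have h5 : logRatio ((-1) ^ m * cfGen N (m + 1)) = logRatio (cfGen N (m + 1)) := by
      rcases neg_one_pow_eq_or (ℤ√(N : ℤ)) m with h | h <;> rw [h]
      · rw [one_mul]
      · rw [neg_one_mul, logRatio_neg]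
    have h6 : ((-1) ^ m * cfGen N (m + 1)).norm = (cfGen N (m + 1)).norm := by
      rcases neg_one_pow_eq_or (ℤ√(N : ℤ)) m with h | h <;> rw [h]
      · rw [one_mul]
      · rw [neg_one_mul, Zsqrtd.norm_neg]
    rw [h5, h6, h1, h3] at h4
    exact h4

theorem stepDist_upsilon_pos {N : ℕ} (hN : ¬ IsSquare N) (m : ℕ) :
    0 < (upsilon N m).stepDist := by
  have hrep := cfGen_isRep hN m
  obtain ⟨-, h2⟩ := hrep.abs_pos hN
  have h3 : (0 : ℝ) < cfP N (m + 1) := by exact_mod_cast cfP_succ_pos hN m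
  have hs := one_lt_sqrt_of_not_isSquare hN
  rw [hrep.stepDist_eq]
  apply mul_pos (by norm_num)
  apply Real.log_pos
  rw [one_lt_div h2]
  have h4 := cfP_lt hN (m + 1)
  have hb : ((upsilon N m).b : ℝ) = 2 * cfP N (m + 1) := by simp [upsilon]
  rw [hb, abs_of_neg (by linarith), abs_of_pos (by linarith)]
  linarith

theorem stepDist_upsilon_le {N : ℕ} (hN : ¬ IsSquare N) (m : ℕ) :
    (upsilon N m).stepDist ≤ Real.log (6 * Real.sqrt N) :=
  (le_abs_self _).trans ((cfGen_isRep hN m).abs_stepDist_le hN)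

theorem pathDist_upsilon_strictMono {N : ℕ} (hN : ¬ IsSquare N) :
    StrictMono (upsilon N 0).pathDist :=
  strictMono_nat_of_lt_succ fun m => by
    rw [pathDist_upsilon_succ hN]
    linarith [stepDist_upsilon_pos hN m]

theorem pathDist_zero (F : BQForm) : F.pathDist 0 = 0 := by simp [BQForm.pathDist]

theorem pathDist_upsilon_le {N : ℕ} (hN : ¬ IsSquare N) (m : ℕ) :
    (upsilon N 0).pathDist m ≤ m * Real.log (6 * Real.sqrt N) := by
  rw [pathDist_upsilon hN, ← nsmul_eq_mul]
  have := Finset.sum_le_card_nsmul (Finset.range m) (fun i => (upsilon N i).stepDist) _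
    fun i _ => stepDist_upsilon_le hN i
  rwa [Finset.card_range] at this

/-! ### The regulator -/

section Regulator

variable {N : ℕ} {ε : Pell.Solution₁ (N : ℤ)}

theorem norm_solution (u : Pell.Solution₁ (N : ℤ)) : (u : ℤ√(N : ℤ)).norm = 1 := by
  have := u.prop
  rw [Zsqrtd.norm_def]
  change u.x * u.x - N * u.y * u.y = 1
  linarith

theorem pellLog_eq (u : Pell.Solution₁ (N : ℤ)) :
    pellLog u = Real.log (sqrtEmbed N (u : ℤ√(N : ℤ))) := by
  rw [pellLog, sqrtEmbed_apply]
  rfl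

theorem logRatio_solution (u : Pell.Solution₁ (N : ℤ)) :
    logRatio (u : ℤ√(N : ℤ)) = pellLog u := by
  have h := sqrtEmbed_mul_star (u : ℤ√(N : ℤ))
  rw [norm_solution, Int.cast_one] at h
  rw [logRatio, pellLog_eq, eq_inv_of_mul_eq_one_right h, div_inv_eq_mul, ← sq, Real.log_abs,
    Real.log_pow]
  push_cast
  ring

theorem one_lt_sqrtEmbed_fundamental (hε : Pell.IsFundamental ε) :
    1 < sqrtEmbed N (ε : ℤ√(N : ℤ)) := by
  rw [sqrtEmbed_apply]
  have h1 : (1 : ℝ) < (ε : ℤ√(N : ℤ)).re := by exact_mod_cast hε.1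
  have h2 : (0 : ℝ) < (ε : ℤ√(N : ℤ)).im := by exact_mod_cast hε.2.1
  have := Real.sqrt_nonneg N
  nlinarith

theorem pellLog_pos (hε : Pell.IsFundamental ε) : 0 < pellLog ε := by
  rw [pellLog_eq]
  exact Real.log_pos (one_lt_sqrtEmbed_fundamental hε)

theorem solution_ne_zero (u : Pell.Solution₁ (N : ℤ)) : (u : ℤ√(N : ℤ)) ≠ 0 := by
  intro h
  have := norm_solution u
  rw [h, Zsqrtd.norm_zero] at this
  exact zero_ne_one this

theorem logRatio_zpow (hN : ¬ IsSquare N) (u : Pell.Solution₁ (N : ℤ)) (k : ℤ) :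
    logRatio ((u ^ k : Pell.Solution₁ (N : ℤ)) : ℤ√(N : ℤ)) = k * pellLog u := by
  let f : Pell.Solution₁ (N : ℤ) →* Multiplicative ℝ :=
    { toFun := fun a => Multiplicative.ofAdd (logRatio (a : ℤ√(N : ℤ)))
      map_one' := by
        change Multiplicative.ofAdd (logRatio (1 : ℤ√(N : ℤ))) = 1
        rw [logRatio_one, ofAdd_zero]
      map_mul' := fun a b => by
        rw [← ofAdd_add, ← logRatio_mul hN (solution_ne_zero a) (solution_ne_zero b)]
        rfl }
  have h := congrArg Multiplicative.toAdd (map_zpow f u k)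
  rw [toAdd_zpow] at h
  change logRatio _ = k • logRatio _ at h
  rw [h, logRatio_solution, zsmul_eq_mul]

theorem exists_logRatio_of_norm_eq_one (hN : ¬ IsSquare N) (hε : Pell.IsFundamental ε)
    {u : ℤ√(N : ℤ)} (hu : u.norm = 1) : ∃ k : ℤ, logRatio u = k * pellLog ε := by
  let v : Pell.Solution₁ (N : ℤ) := ⟨u, Zsqrtd.norm_eq_one_iff_mem_unitary.1 hu⟩
  obtain ⟨k, hk | hk⟩ := hε.eq_zpow_or_neg_zpow v
  · refine ⟨k, ?_⟩
    rw [← logRatio_zpow hN, ← hk]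
  · refine ⟨k, ?_⟩
    rw [← logRatio_zpow hN, ← logRatio_neg]
    have : ((-v : Pell.Solution₁ (N : ℤ)) : ℤ√(N : ℤ)) = -u := rfl
    rw [← this, hk, neg_neg]

theorem exists_logRatio_sub (hN : ¬ IsSquare N) (hε : Pell.IsFundamental ε) {F : BQForm}
    {γ γ' : ℤ√(N : ℤ)} (h : F.IsRep N γ) (h' : F.IsRep N γ') :
    ∃ k : ℤ, logRatio γ' = logRatio γ + k * pellLog ε := by
  obtain ⟨u, hu, rfl⟩ := h.exists_unit hN h'
  obtain ⟨k, hk⟩ := exists_logRatio_of_norm_eq_one hN hε hu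
  refine ⟨k, ?_⟩
  have hu0 : u ≠ 0 := by
    rintro rfl
    rw [Zsqrtd.norm_zero] at hu
    exact zero_ne_one hu
  rw [logRatio_mul hN hu0 h.ne_zero, hk]
  ring

end Regulator

/-! ### Reduced principal forms lie on the principal cycle -/

theorem abs_add_ge_of_mul_nonneg {x y : ℝ} (h : 0 ≤ x * y) : |x| ≤ |x + y| ∧ |y| ≤ |x + y| := by
  rw [abs_add_of_mul_nonneg h]
  exact ⟨by linarith [abs_nonneg y], by linarith [abs_nonneg x]⟩
where
  abs_add_of_mul_nonneg {x y : ℝ} (h : 0 ≤ x * y) : |x + y| = |x| + |y| := by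
    rcases mul_nonneg_iff.1 h with ⟨h1, h2⟩ | ⟨h1, h2⟩
    · rw [abs_of_nonneg h1, abs_of_nonneg h2, abs_of_nonneg (by linarith)]
    · rw [abs_of_nonpos h1, abs_of_nonpos h2, abs_of_nonpos (by linarith)]
      ring

theorem abs_le_abs_intCast_mul {p : ℤ} (hp : p ≠ 0) (x : ℝ) : |x| ≤ |(p : ℝ) * x| := by
  rw [abs_mul]
  have : (1 : ℝ) ≤ |(p : ℝ)| := by exact_mod_cast Int.one_le_abs hp
  exact le_mul_of_one_le_left (abs_nonneg _) this

/-- The elements of a basis attached to an indefinite form with `ac < 0` are minimal points. -/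
theorem abs_star_le_of_abs_lt {N : ℕ} {γ η ξ : ℤ√(N : ℤ)} {B : ℤ}
    (e : star γ * η = ⟨B, 1⟩) (hB : |(B : ℝ)| < Real.sqrt N) (hξ : ξ ≠ 0)
    (hlt : |sqrtEmbed N ξ| < |sqrtEmbed N η|) :
    |sqrtEmbed N (star γ)| ≤ |sqrtEmbed N (star ξ)| := by
  obtain ⟨-, hdet⟩ := BQForm.basis_coords e
  set p := ξ.re * η.im - ξ.im * η.re with hp
  set q := γ.re * ξ.im - γ.im * ξ.re with hq
  have hcomb : ξ = p * γ + q * η := by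
    ext
    · simp
      linear_combination (-ξ.re) * hdet
    · simp
      linear_combination (-ξ.im) * hdet
  have h1 : sqrtEmbed N ξ = p * sqrtEmbed N γ + q * sqrtEmbed N η := by
    rw [hcomb]; simp only [map_add, map_mul, map_intCast]
  have h2 : sqrtEmbed N (star ξ) = p * sqrtEmbed N (star γ) + q * sqrtEmbed N (star η) := by
    rw [hcomb]; simp only [map_add, map_mul, map_intCast, star_add, star_mul', star_intCast]
  have e1 : sqrtEmbed N (star γ) * sqrtEmbed N η = B + Real.sqrt N := by
    rw [← map_mul, e, sqrtEmbed_apply]; simp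
  have e2 : sqrtEmbed N γ * sqrtEmbed N (star η) = B - Real.sqrt N := by
    have : γ * star η = star (⟨B, 1⟩ : ℤ√(N : ℤ)) := by rw [← e, star_mul', star_star]
    rw [← map_mul, this, sqrtEmbed_star]; simp
  rw [abs_lt] at hB
  -- Since B² < N, the products γη and γ̄η̄ have opposite signs. So in ξ = pγ + qη and in its
  -- conjugate, exactly one pair of terms reinforces when p, q ≠ 0. If it is the first pair, |ξ| ≥
  -- |η|, which is excluded; hence |ξ̄| ≥ |γ̄|.
  have hneg : (sqrtEmbed N γ * sqrtEmbed N η) *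
      (sqrtEmbed N (star γ) * sqrtEmbed N (star η)) < 0 := by
    have : (sqrtEmbed N γ * sqrtEmbed N η) * (sqrtEmbed N (star γ) * sqrtEmbed N (star η)) =
      (B + Real.sqrt N) * (B - Real.sqrt N) := by rw [← e1, ← e2]; ring
    rw [this]
    exact mul_neg_of_pos_of_neg (by linarith) (by linarith)
  rcases eq_or_ne p 0 with hp0 | hp0
  · exfalso
    rw [hp0, Int.cast_zero, zero_mul, zero_add] at h1
    have hq0 : q ≠ 0 := by
      intro hq0
      apply hξ
      rw [hcomb, hp0, hq0]
      simp
    rw [h1] at hlt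
    exact absurd (abs_le_abs_intCast_mul hq0 (sqrtEmbed N η)) (not_le.2 hlt)
  rcases eq_or_ne q 0 with hq0 | hq0
  · rw [hq0, Int.cast_zero, zero_mul, add_zero] at h2
    rw [h2]
    exact abs_le_abs_intCast_mul hp0 _
  rcases le_total 0 ((p * sqrtEmbed N γ) * (q * sqrtEmbed N η)) with h | h
  · exfalso
    have h3 := (abs_add_ge_of_mul_nonneg h).2
    rw [← h1] at h3
    exact absurd ((abs_le_abs_intCast_mul hq0 (sqrtEmbed N η)).trans h3) (not_le.2 hlt)
  · have h' : 0 ≤ (p * sqrtEmbed N (star γ)) * (q * sqrtEmbed N (star η)) := by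
      by_contra hlt'
      rw [not_le] at hlt'
      have h4 : 0 ≤ ((p * sqrtEmbed N γ) * (q * sqrtEmbed N η)) *
        ((p * sqrtEmbed N (star γ)) * (q * sqrtEmbed N (star η))) :=
        mul_nonneg_of_nonpos_of_nonpos h hlt'.le
      have h5 : ((p * sqrtEmbed N γ) * (q * sqrtEmbed N η)) *
        ((p * sqrtEmbed N (star γ)) * (q * sqrtEmbed N (star η))) =
        ((p : ℝ) * q) ^ 2 * ((sqrtEmbed N γ * sqrtEmbed N η) *
          (sqrtEmbed N (star γ) * sqrtEmbed N (star η))) := by ring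
      have hp' : (p : ℝ) ≠ 0 := by exact_mod_cast hp0
      have hq' : (q : ℝ) ≠ 0 := by exact_mod_cast hq0
      have h6 : 0 < ((p : ℝ) * q) ^ 2 := by positivity
      rw [h5] at h4
      nlinarith
    have h3 := (abs_add_ge_of_mul_nonneg h').1
    rw [← h2] at h3
    exact (abs_le_abs_intCast_mul hp0 _).trans h3

theorem sqrtEmbed_eq_or_eq_neg {N : ℕ} (hN : ¬ IsSquare N) {γ γ' : ℤ√(N : ℤ)}
    (h : |sqrtEmbed N (star γ)| = |sqrtEmbed N (star γ')|) : γ = γ' ∨ γ = -γ' := by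
  rcases abs_eq_abs.1 h with h | h
  · exact Or.inl (star_injective (sqrtEmbed_injective hN h))
  · rw [← map_neg] at h
    right
    have := sqrtEmbed_injective hN h
    rw [← star_neg] at this
    exact star_injective this

namespace BQForm

/-- Reducedness confines b to the open interval (2√N − 2|a|, 2√N), which contains at most one
integer from each class modulo 2a. -/
theorem IsRep.eq_of_isReduced {N : ℕ} (hN : ¬ IsSquare N) {F F' : BQForm} {γ : ℤ√(N : ℤ)}
    (h : F.IsRep N γ) (h' : F'.IsRep N γ) (hr : F.IsReduced) (hr' : F'.IsReduced) : F = F' := by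
  obtain ⟨ha, hdvd⟩ := h.eq_of_dvd h'
  have ha0 := h.a_ne_zero hN
  obtain ⟨h1, h2⟩ := h.isReduced_iff.1 hr
  obtain ⟨h1', h2'⟩ := h'.isReduced_iff.1 hr'
  rw [← ha] at h1'
  rw [abs_lt] at h1 h1'
  have hb : F.b = F'.b := by
    have h3 : |(F.b : ℝ) - F'.b| < 2 * |(F.a : ℝ)| := by
      rw [abs_lt]
      constructor <;> linarith
    have h4 : |F.b - F'.b| < 2 * |F.a| := by exact_mod_cast h3
    have := Int.eq_zero_of_abs_lt_dvd ((abs_dvd _ _).2 hdvd) (by rwa [abs_mul, abs_two])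
    linarith
  have hd := h.disc_eq
  have hd' := h'.disc_eq
  rw [disc] at hd hd'
  rw [← ha, ← hb] at hd'
  ext
  · exact ha
  · exact hb
  · exact mul_left_cancel₀ (mul_ne_zero four_ne_zero ha0) (by linarith)

/-- Choose n so that |γ| lies between the consecutive convergents g_n ≤ |γ| < g_{n+1}. Minimality of
g_n against γ, and of γ against g_n, gives |γ̄| = |ḡ_n|, hence γ = ±g_n. -/
theorem IsRep.exists_cfGen {N : ℕ} (hN : ¬ IsSquare N) {F : BQForm} {γ : ℤ√(N : ℤ)}
    (h : F.IsRep N γ) (hr : F.IsReduced) (hγ : 1 ≤ |sqrtEmbed N γ|) :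
    ∃ n, F = upsilon N n ∧ logRatio γ = (upsilon N 0).pathDist n := by
  have hex : ∃ m, |sqrtEmbed N γ| < sqrtEmbed N (cfGen N m) := by
    obtain ⟨m, hm⟩ := exists_nat_gt |sqrtEmbed N γ|
    exact ⟨m + 1, by linarith [(cfGen_growth hN m).2.1]⟩
  classical
  obtain ⟨n, hn⟩ : ∃ n, Nat.find hex = n + 1 := by
    refine Nat.exists_eq_succ_of_ne_zero fun h0 => ?_
    have := Nat.find_spec hex
    rw [h0] at this
    simp only [cfGen, map_one] at this
    linarith
  have hlt := Nat.find_spec hex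
  have hge : sqrtEmbed N (cfGen N n) ≤ |sqrtEmbed N γ| :=
    not_lt.1 (Nat.find_min hex (by omega : n < Nat.find hex))
  rw [hn] at hlt
  have hrep := cfGen_isRep hN n
  have hP := cfP_lt hN (n + 1)
  have hP0 : (0 : ℝ) < cfP N (n + 1) := by exact_mod_cast cfP_succ_pos hN n
  have hpos := (cfGen_growth hN n).1
  have e' : star (cfGen N n) * ((-1) ^ n * cfGen N (n + 1)) = ⟨cfP N (n + 1), 1⟩ := by
    rw [mul_left_comm, (cfGen_basis hN n).2, ← mul_assoc, ← mul_pow]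
    simp
  have hle1 : |sqrtEmbed N (star (cfGen N n))| ≤ |sqrtEmbed N (star γ)| := by
    refine abs_star_le_of_abs_lt e' (by rwa [abs_of_pos hP0]) h.ne_zero ?_
    rw [map_mul, abs_mul, map_pow, map_neg, map_one, abs_neg_one_pow, one_mul]
    exact hlt.trans_le (le_abs_self _)
  have hred := h.isReduced_iff.1 hr
  have hle2 : |sqrtEmbed N (star γ)| ≤ |sqrtEmbed N (star (cfGen N n))| := by
    obtain ⟨η, B, e, rfl⟩ := h
    obtain ⟨h1, h2⟩ := hred
    simp only at h1 h2
    push_cast at h1 h2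
    rw [abs_lt] at h1
    have hB : 0 < (B : ℝ) := by linarith
    refine abs_star_le_of_abs_lt e ?_ hrep.ne_zero ?_
    · rw [abs_of_pos hB]; linarith
    · have hγ0 : 0 < |sqrtEmbed N (star γ)| := by
        have : γ ≠ 0 := by rintro rfl; simp at hγ; linarith
        exact _root_.abs_pos.2 (sqrtEmbed_star_ne_zero hN this)
      rw [abs_of_pos (by linarith : 0 < sqrtEmbed N (cfGen N n))]
      refine hge.trans_lt ?_
      -- After multiplication by |γ̄|, the claim |γ| < |η| reads |a| < B + √N, a consequence of
      -- reducedness.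
      refine lt_of_mul_lt_mul_left ?_ hγ0.le
      rw [← abs_mul, ← abs_mul, mul_comm, sqrtEmbed_mul_star, ← map_mul, e, sqrtEmbed_apply]
      simp only [Int.cast_one, one_mul]
      refine lt_of_lt_of_le ?_ (le_abs_self _)
      linarith
  rcases sqrtEmbed_eq_or_eq_neg hN (le_antisymm hle2 hle1) with rfl | rfl
  · exact ⟨n, h.eq_of_isReduced hN hrep hr (upsilon_isReduced hN n), logRatio_cfGen hN n⟩
  · exact ⟨n, h.eq_of_isReduced hN hrep.neg hr (upsilon_isReduced hN n),
      by rw [logRatio_neg, logRatio_cfGen hN n]⟩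

/-- Multiplying γ by a power of ε leaves the form unchanged, shifts the position by a multiple of R⁺
and achieves |γ| ≥ 1. -/
theorem IsPrincipalAt.exists_upsilon {N : ℕ} (hN : ¬ IsSquare N) {ε : Pell.Solution₁ (N : ℤ)}
    (hε : Pell.IsFundamental ε) {F : BQForm} {x : ℝ} (h : F.IsPrincipalAt N x) :
    ∃ (n : ℕ) (k : ℤ), F = upsilon N n ∧ (upsilon N 0).pathDist n = x + k * pellLog ε := by
  obtain ⟨hr, γ, hrep, rfl⟩ := h
  have h1 := one_lt_sqrtEmbed_fundamental hε
  have hγ : 0 < |sqrtEmbed N γ| := _root_.abs_pos.2 (sqrtEmbed_ne_zero hN hrep.ne_zero)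
  obtain ⟨j, hj⟩ := pow_unbounded_of_one_lt (|sqrtEmbed N γ|)⁻¹ h1
  have hrep' := hrep.mul_unit (norm_solution (ε ^ j))
  have hcoe : ((ε ^ j : Pell.Solution₁ (N : ℤ)) : ℤ√(N : ℤ)) = (ε : ℤ√(N : ℤ)) ^ j := rfl
  obtain ⟨n, hn, hlog⟩ := hrep'.exists_cfGen hN hr (by
    rw [hcoe, map_mul, map_pow, abs_mul, abs_of_pos (by positivity)]
    rw [inv_lt_iff_one_lt_mul₀ hγ] at hj
    linarith)
  refine ⟨n, j, hn, ?_⟩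
  have hz := logRatio_zpow hN ε (j : ℤ)
  rw [zpow_natCast] at hz
  rw [← hlog, logRatio_mul hN (solution_ne_zero _) hrep.ne_zero, hz, add_comm]

end BQForm

theorem upsilon_isPrincipalAt {N : ℕ} (hN : ¬ IsSquare N) (n : ℕ) :
    (upsilon N n).IsPrincipalAt N ((upsilon N 0).pathDist n) :=
  ⟨upsilon_isReduced hN n, cfGen N n, cfGen_isRep hN n, logRatio_cfGen hN n⟩

/-! ### The principal cycle and the regulator -/

section Cycle

variable {N : ℕ} (hN : ¬ IsSquare N) {ε : Pell.Solution₁ (N : ℤ)} (hε : Pell.IsFundamental ε)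
include hN hε

/-- Both 1 and ε represent Υ_0; locating ε among the convergents gives T. -/
theorem exists_cycle_length :
    ∃ T, 0 < T ∧ upsilon N T = upsilon N 0 ∧ (upsilon N 0).pathDist T = pellLog ε := by
  have h := (cfGen_isRep hN 0).mul_unit (norm_solution ε)
  have h1 := one_lt_sqrtEmbed_fundamental hε
  have h2 : (ε : ℤ√(N : ℤ)) * cfGen N 0 = ε := mul_one _
  rw [h2] at h
  obtain ⟨n, hn, hlog⟩ := h.exists_cfGen hN (upsilon_isReduced hN 0) (h1.le.trans (le_abs_self _))
  rw [logRatio_solution] at hlog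
  refine ⟨n, Nat.pos_of_ne_zero ?_, hn.symm, hlog.symm⟩
  rintro rfl
  rw [pathDist_zero] at hlog
  exact (pellLog_pos hε).ne' hlog

theorem exists_pathDist_sub {m n : ℕ} (h : upsilon N m = upsilon N n) :
    ∃ k : ℤ, (upsilon N 0).pathDist n = (upsilon N 0).pathDist m + k * pellLog ε := by
  have h1 := cfGen_isRep hN m
  rw [h] at h1
  rw [← logRatio_cfGen hN, ← logRatio_cfGen hN]
  exact exists_logRatio_sub hN hε h1 (cfGen_isRep hN n)

theorem delta_upsilon (n : ℕ) :
    0 ≤ BQForm.delta (upsilon N 0) (upsilon N n) ∧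
    BQForm.delta (upsilon N 0) (upsilon N n) < pellLog ε ∧
    ∃ k : ℤ, BQForm.delta (upsilon N 0) (upsilon N n) =
      (upsilon N 0).pathDist n + k * pellLog ε := by
  obtain ⟨T, hT, hTe, hTR⟩ := exists_cycle_length hN hε
  have hset : {k : ℕ | BQForm.rho^[k] (upsilon N 0) = upsilon N n} =
      {k : ℕ | upsilon N k = upsilon N n} := by
    ext k
    rw [Set.mem_ofPred_eq, iterate_rho_upsilon hN, zero_add, Set.mem_ofPred_eq]
  have hper : Function.Periodic (upsilon N) T := fun k => by
    rw [add_comm, ← iterate_rho_upsilon hN, hTe, iterate_rho_upsilon hN, zero_add]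
  have hmod : n % T ∈ {k : ℕ | upsilon N k = upsilon N n} := hper.map_mod_nat n
  rw [BQForm.delta, hset]
  set m := sInf {k : ℕ | upsilon N k = upsilon N n}
  have hm : upsilon N m = upsilon N n := Nat.sInf_mem ⟨_, hmod⟩
  have hmT : m < T := (Nat.sInf_le hmod).trans_lt (Nat.mod_lt _ hT)
  have hmono := pathDist_upsilon_strictMono hN
  refine ⟨?_, ?_, exists_pathDist_sub hN hε hm.symm⟩
  · rw [← pathDist_zero (upsilon N 0)]
    exact hmono.monotone (Nat.zero_le m)
  · rw [← hTR]
    exact hmono hmT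

/-- The forms Υ_0, …, Υ_{T−1} are distinct, because two of them are less than R⁺ apart. Each is
determined by its first two coefficients, so T ≤ (4N + 1)(N + 1) ≤ 10N². The bound serves to make ln
R⁺ = O(ln N). -/
theorem pellLog_le : pellLog ε ≤ 10 * N ^ 2 * Real.log (6 * Real.sqrt N) := by
  obtain ⟨T, hT, hTe, hTR⟩ := exists_cycle_length hN hε
  have hR := pellLog_pos hε
  have hmono := pathDist_upsilon_strictMono hN
  have hL := BQForm.log_six_sqrt_pos hN
  have hs := one_lt_sqrt_of_not_isSquare hN
  have hsN : Real.sqrt N ≤ N := by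
    have := Real.sq_sqrt (Nat.cast_nonneg (α := ℝ) N)
    nlinarith
  have hinj : ∀ i < T, ∀ j < T, i < j → upsilon N i ≠ upsilon N j := by
    intro i _ j hj hij he
    obtain ⟨k, hk⟩ := exists_pathDist_sub hN hε he
    have h1 := hmono hij
    have h2 := hmono hj
    have h3 := hmono.monotone (Nat.zero_le i)
    rw [pathDist_zero] at h3
    rw [hTR] at h2
    have hk0 : 0 < k := by
      by_contra hle
      have : (k : ℝ) ≤ 0 := by exact_mod_cast not_lt.1 hle
      nlinarith
    have : (1 : ℝ) ≤ k := by exact_mod_cast hk0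
    nlinarith
  have hcard : T ≤ (4 * N + 1) * (N + 1) := by
    have hmaps : Set.MapsTo (fun m => ((upsilon N m).a, cfP N (m + 1)))
        (Finset.range T : Set ℕ)
        ((Finset.Icc (-(2 * N : ℤ)) (2 * N) ×ˢ Finset.Icc (0 : ℤ) N : Finset (ℤ × ℤ)) :
          Set (ℤ × ℤ)) := by
      intro m _
      have h1 := (cfGen_isRep hN m).abs_a_lt (upsilon_isReduced hN m)
      have h2 := cfP_lt hN (m + 1)
      have h3 := cfP_succ_pos hN m
      have h4 : |((upsilon N m).a : ℝ)| ≤ 2 * N := by linarith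
      have h5 : |(upsilon N m).a| ≤ 2 * N := by exact_mod_cast h4
      have h6 : (cfP N (m + 1) : ℝ) ≤ N := by linarith
      have h7 : cfP N (m + 1) ≤ N := by exact_mod_cast h6
      rw [abs_le] at h5
      simp only [Finset.coe_product, Finset.coe_Icc, Set.mem_prod, Set.mem_Icc]
      exact ⟨h5, h3.le, h7⟩
    have hinj' : Set.InjOn (fun m => ((upsilon N m).a, cfP N (m + 1)))
        (Finset.range T : Set ℕ) := by
      intro i hi j hj he
      simp only [Finset.coe_range, Set.mem_Iio] at hi hj
      simp only [Prod.mk.injEq] at he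
      have hu : upsilon N i = upsilon N j := by
        have h1 := (cfGen_isRep hN i).disc_eq
        have h2 := (cfGen_isRep hN j).disc_eq
        have hb : (upsilon N i).b = (upsilon N j).b := by simp [upsilon, he.2]
        rw [BQForm.disc] at h1 h2
        rw [← he.1, ← hb] at h2
        ext
        · exact he.1
        · exact hb
        · exact mul_left_cancel₀ (mul_ne_zero four_ne_zero
            ((cfGen_isRep hN i).a_ne_zero hN)) (by linarith)
      rcases lt_trichotomy i j with h | h | h
      · exact absurd hu (hinj i hi j hj h)
      · exact h
      · exact absurd hu.symm (hinj j hj i hi h)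
    have := Finset.card_le_card_of_injOn _ hmaps hinj'
    rw [Finset.card_range, Finset.card_product, Int.card_Icc, Int.card_Icc] at this
    refine this.trans (le_of_eq ?_)
    (congr 1; all_goals omega)
  have hT' : (T : ℝ) ≤ 10 * N ^ 2 := by
    have h1 : (T : ℝ) ≤ (4 * N + 1) * (N + 1) := by exact_mod_cast hcard
    nlinarith
  rw [← hTR]
  exact (pathDist_upsilon_le hN T).trans (mul_le_mul_of_nonneg_right hT' hL.le)

end Cycle

/-! ### The period of the continued fraction -/

theorem eq_of_mem_window {x : ℝ} {a b q k : ℤ} (ha : x - q < a) (ha' : (a : ℝ) < x)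
    (hb : x - q < b) (hb' : (b : ℝ) < x) (h : a - b = q * k) : a = b := by
  have h1 : |(a : ℝ) - b| < q := by
    rw [abs_lt]
    constructor <;> linarith
  have h2 : |a - b| < q := by exact_mod_cast h1
  have := Int.eq_zero_of_abs_lt_dvd ⟨k, h⟩ h2
  linarith

theorem cfPQ_add_eq {N i j : ℕ} (hP : cfP N i = cfP N j) (hQ : cfQ N i = cfQ N j) (n : ℕ) :
    cfP N (i + n) = cfP N (j + n) ∧ cfQ N (i + n) = cfQ N (j + n) := by
  induction n with
  | zero => exact ⟨hP, hQ⟩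
  | succ n ih =>
    obtain ⟨h1, h2⟩ := ih
    have h3 : cfP N (i + (n + 1)) = cfP N (j + (n + 1)) := by
      rw [← add_assoc, ← add_assoc, cfP_succ, cfP_succ, cfA, cfA, h1, h2]
    refine ⟨h3, ?_⟩
    rw [← add_assoc, ← add_assoc] at h3 ⊢
    rw [cfQ_succ, cfQ_succ, h3, h2]

section

variable {N : ℕ} (hN : ¬ IsSquare N)
include hN

/-- If Q_k = 1, then P_{k+1} is the only integer in (√N − 1, √N), which is P_1. The index of P
starts at 1 because P_0 = 0 does not recur. -/
theorem cfP_cfQ_add_of_cfQ_eq_one {k : ℕ} (hk : cfQ N k = 1) (n : ℕ) :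
    cfP N (n + 1 + k) = cfP N (n + 1) ∧ cfQ N (n + k) = cfQ N n := by
  have hQ0 : cfQ N 0 = 1 := rfl
  have hP : cfP N (k + 1) = cfP N (0 + 1) := by
    have h1 := sqrt_sub_cfQ_lt hN k
    have h2 := cfP_lt hN (k + 1)
    have h3 := sqrt_sub_cfQ_lt hN 0
    have h4 := cfP_lt hN (0 + 1)
    rw [hk] at h1
    rw [hQ0] at h3
    exact eq_of_mem_window h1 h2 h3 h4 (one_mul _).symm
  have hQ : cfQ N (k + 1) = cfQ N (0 + 1) := by rw [cfQ_succ, cfQ_succ, hP, hk, hQ0]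
  have h5 := cfPQ_add_eq hP hQ
  refine ⟨?_, ?_⟩
  · have := (h5 n).1
    rwa [show k + 1 + n = n + 1 + k by ring, show 0 + 1 + n = n + 1 by ring] at this
  · rcases n with _ | n
    · rw [zero_add, hk, hQ0]
    · have := (h5 n).2
      rwa [show k + 1 + n = n + 1 + k by ring, show 0 + 1 + n = n + 1 by ring] at this

theorem upsilon_eq_zero_iff (k : ℕ) : upsilon N k = upsilon N 0 ↔ Even k ∧ cfQ N k = 1 := by
  have hQ0 : cfQ N 0 = 1 := rfl
  have hpos := cfQ_pos hN k
  constructor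
  · intro h
    have ha := congrArg BQForm.a h
    simp only [upsilon, hQ0, pow_zero, mul_one] at ha
    rcases Nat.even_or_odd k with hk | hk
    · rw [hk.neg_one_pow, one_mul] at ha
      exact ⟨hk, ha⟩
    · rw [hk.neg_one_pow] at ha
      omega
  · rintro ⟨hk, hQ⟩
    have h1 := cfP_cfQ_add_of_cfQ_eq_one hN hQ 0
    have h2 := cfP_cfQ_add_of_cfQ_eq_one hN hQ 1
    rw [upsilon, upsilon, pow_succ, hk.neg_one_pow, hQ, hQ0, add_comm k 1, h2.2]
    rw [zero_add] at h1
    rw [h1.1]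
    simp

/-- The complete quotients of `√N`. -/
theorem cf_complete_quotient (n : ℕ) :
    1 < ((cfP N n : ℝ) + Real.sqrt N) / cfQ N n ∧
    (((cfP N n : ℝ) + Real.sqrt N) / cfQ N n - cfA N n) *
      (((cfP N (n + 1) : ℝ) + Real.sqrt N) / cfQ N (n + 1)) = 1 := by
  have h1 : (0 : ℝ) < cfQ N n := by exact_mod_cast cfQ_pos hN n
  have h2 : (0 : ℝ) < cfQ N (n + 1) := by exact_mod_cast cfQ_pos hN (n + 1)
  have h3 := cfQ_lt hN n
  have h4 : (cfQ N n : ℝ) * cfQ N (n + 1) = Real.sqrt N ^ 2 - cfP N (n + 1) ^ 2 := by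
    rw [Real.sq_sqrt (Nat.cast_nonneg N)]
    exact_mod_cast cfQ_mul_cfQ_succ hN n
  have h5 : (cfP N (n + 1) : ℝ) = cfA N n * cfQ N n - cfP N n := by
    rw [cfP_succ]; push_cast; ring
  refine ⟨by rw [one_lt_div h1]; exact h3, ?_⟩
  have h6 : ((cfP N n : ℝ) + Real.sqrt N) / cfQ N n - cfA N n =
      (Real.sqrt N - cfP N (n + 1)) / cfQ N n := by
    rw [h5]
    field_simp
    ring
  rw [h6, div_mul_div_comm, h4, div_eq_one_iff_eq]
  · ring
  · rw [← h4]; positivity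

/-- With equal partial quotients, |θ_{n+k} − θ_n| is multiplied at each step by a product of two
complete quotients, which exceeds 1. A nonzero difference would grow strictly, but the θ_n are
periodic with period T. So θ_{k+1} = θ_1; irrationality of √N yields equal P and Q, and Q_kQ_{k+1} =
N − P_{k+1}² then gives Q_k = 1. -/
theorem cfQ_eq_one_of_cfA_periodic {ε : Pell.Solution₁ (N : ℤ)} (hε : Pell.IsFundamental ε)
    {k : ℕ} (h : ∀ n : ℕ, 1 ≤ n → cfA N (n + k) = cfA N n) : cfQ N k = 1 := by
  obtain ⟨T, hT, hTe, -⟩ := exists_cycle_length hN hε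
  have hQT := ((upsilon_eq_zero_iff hN T).1 hTe).2
  have hQ0 : cfQ N 0 = 1 := rfl
  set θ : ℕ → ℝ := fun n => ((cfP N n : ℝ) + Real.sqrt N) / cfQ N n with hθ
  have hgt : ∀ n, 1 < θ n := fun n => (cf_complete_quotient hN n).1
  have hrec : ∀ n, (θ n - cfA N n) * θ (n + 1) = 1 := fun n => (cf_complete_quotient hN n).2
  have hper : ∀ n, θ (n + 1 + T) = θ (n + 1) := fun n => by
    have h1 := (cfP_cfQ_add_of_cfQ_eq_one hN hQT n).1
    have h2 := (cfP_cfQ_add_of_cfQ_eq_one hN hQT (n + 1)).2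
    simp only [hθ]
    rw [h1, h2]
  set d : ℕ → ℝ := fun n => θ (n + 1 + k) - θ (n + 1) with hd
  have hdrec : ∀ n, |d (n + 1)| = |d n| * (θ (n + 2) * θ (n + 2 + k)) := fun n => by
    have h1 := hrec (n + 1)
    have h2 := hrec (n + 1 + k)
    rw [h (n + 1) (by omega), show n + 1 + k + 1 = n + 2 + k by ring] at h2
    have h3 : d (n + 1) = -(d n * (θ (n + 2) * θ (n + 2 + k))) := by
      change θ (n + 2 + k) - θ (n + 2) =
        -((θ (n + 1 + k) - θ (n + 1)) * (θ (n + 2) * θ (n + 2 + k)))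
      linear_combination θ (n + 2) * h2 - θ (n + 2 + k) * h1
    rw [h3, abs_neg, abs_mul, abs_of_pos (a := θ (n + 2) * θ (n + 2 + k))
      (mul_pos (by linarith [hgt (n + 2)]) (by linarith [hgt (n + 2 + k)]))]
  have hd0 : d 0 = 0 := by
    by_contra hne
    have hpos : ∀ n, 0 < |d n| := by
      intro n
      induction n with
      | zero => exact abs_pos.2 hne
      | succ n ih =>
        rw [hdrec]
        have := hgt (n + 2)
        have := hgt (n + 2 + k)
        positivity
    have hmono : StrictMono fun n => |d n| := strictMono_nat_of_lt_succ fun n => by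
      rw [hdrec]
      exact lt_mul_of_one_lt_right (hpos n)
        (one_lt_mul_of_lt_of_le (hgt _) (hgt _).le)
    have h1 : d T = d 0 := by
      simp only [hd]
      have e1 := hper (0 + k)
      have e2 := hper 0
      rw [show 0 + k + 1 + T = T + 1 + k by ring, show 0 + k + 1 = 0 + 1 + k by ring] at e1
      rw [show 0 + 1 + T = T + 1 by ring] at e2
      rw [e1, e2]
    have h2 := hmono hT
    simp only [h1, lt_irrefl] at h2
  have hA : (0 : ℝ) < cfQ N (1 + k) := by exact_mod_cast cfQ_pos hN _
  have hB : (0 : ℝ) < cfQ N 1 := by exact_mod_cast cfQ_pos hN _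
  have heq : ((cfP N (1 + k) : ℝ) + Real.sqrt N) / cfQ N (1 + k) =
      ((cfP N 1 : ℝ) + Real.sqrt N) / cfQ N 1 := sub_eq_zero.1 hd0
  rw [div_eq_div_iff hA.ne' hB.ne'] at heq
  have hz : (⟨cfP N (1 + k) * cfQ N 1, cfQ N 1⟩ : ℤ√(N : ℤ)) =
      ⟨cfP N 1 * cfQ N (1 + k), cfQ N (1 + k)⟩ := by
    apply sqrtEmbed_injective hN
    rw [sqrtEmbed_apply, sqrtEmbed_apply]
    push_cast
    linarith
  rw [Zsqrtd.mk.injEq] at hz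
  obtain ⟨h1, h2⟩ := hz
  rw [← h2] at h1
  have hQ1 := cfQ_pos hN 1
  have h3 := mul_right_cancel₀ hQ1.ne' h1
  have h4 := cfQ_mul_cfQ_succ hN k
  have h5 := cfQ_mul_cfQ_succ hN 0
  rw [add_comm k 1, ← h2, h3] at h4
  rw [hQ0, one_mul, zero_add] at h5
  exact mul_right_cancel₀ hQ1.ne' (by rw [h4, one_mul, h5])

theorem cfPeriod_spec {ε : Pell.Solution₁ (N : ℤ)} (hε : Pell.IsFundamental ε) :
    0 < cfPeriod N ∧ cfQ N (cfPeriod N) = 1 ∧ ∀ k, 0 < k → cfQ N k = 1 → cfPeriod N ≤ k := by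
  have hset : {k : ℕ | 0 < k ∧ ∀ n : ℕ, 1 ≤ n → cfA N (n + k) = cfA N n} =
      {k : ℕ | 0 < k ∧ cfQ N k = 1} := by
    ext k
    simp only [Set.mem_ofPred_eq]
    refine and_congr_right fun _ => ⟨cfQ_eq_one_of_cfA_periodic hN hε, fun hk n hn => ?_⟩
    obtain ⟨n, rfl⟩ := Nat.exists_eq_succ_of_ne_zero (by omega : n ≠ 0)
    have h1 := (cfP_cfQ_add_of_cfQ_eq_one hN hk n).1
    have h2 := (cfP_cfQ_add_of_cfQ_eq_one hN hk (n + 1)).2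
    rw [Nat.succ_eq_add_one, cfA, cfA, h1, h2]
  obtain ⟨T, hT, hTe, -⟩ := exists_cycle_length hN hε
  have hQT := ((upsilon_eq_zero_iff hN T).1 hTe).2
  have hne : {k : ℕ | 0 < k ∧ cfQ N k = 1}.Nonempty := ⟨T, hT, hQT⟩
  rw [cfPeriod, hset]
  exact ⟨(Nat.sInf_mem hne).1, (Nat.sInf_mem hne).2, fun k h1 h2 => Nat.sInf_le ⟨h1, h2⟩⟩

theorem stepDist_upsilon_congr {m n : ℕ} (h : cfP N (m + 1) = cfP N (n + 1)) :
    (upsilon N m).stepDist = (upsilon N n).stepDist := by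
  rw [BQForm.stepDist, BQForm.stepDist, (cfGen_isRep hN m).disc_eq, (cfGen_isRep hN n).disc_eq]
  simp only [upsilon, h]

theorem pathDist_add_of_cfQ_eq_one {k : ℕ} (hk : cfQ N k = 1) (n : ℕ) :
    (upsilon N 0).pathDist (k + n) = (upsilon N 0).pathDist k + (upsilon N 0).pathDist n := by
  rw [pathDist_upsilon hN, pathDist_upsilon hN, pathDist_upsilon hN, Finset.sum_range_add]
  congr 1
  refine Finset.sum_congr rfl fun i _ => stepDist_upsilon_congr hN ?_
  rw [← (cfP_cfQ_add_of_cfQ_eq_one hN hk i).1]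
  congr 1
  ring

/-- The symmetry of the continued fraction of `√N`. -/
theorem cf_symmetry {τ : ℕ} (hτ : cfQ N τ = 1) (i : ℕ) : ∀ j, i + j + 1 = τ →
    cfP N (i + 1) = cfP N (j + 1) ∧ cfQ N i = cfQ N (j + 1) := by
  have hQ0 : cfQ N 0 = 1 := rfl
  induction i with
  | zero =>
    intro j hj
    rw [zero_add] at hj
    subst hj
    refine ⟨?_, by rw [hQ0, hτ]⟩
    have h1 := sqrt_sub_cfQ_lt hN 0
    have h2 := cfP_lt hN (0 + 1)
    have h3 := sqrt_sub_cfQ_succ_lt hN j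
    have h4 := cfP_lt hN (j + 1)
    rw [hQ0] at h1
    rw [hτ] at h3
    exact eq_of_mem_window h1 h2 h3 h4 (one_mul _).symm
  | succ i ih =>
    intro j hj
    obtain ⟨h1, h2⟩ := ih (j + 1) (by omega)
    have h3 := cfQ_mul_cfQ_succ hN i
    have h4 := cfQ_mul_cfQ_succ hN (j + 1)
    have hQ : cfQ N (i + 1) = cfQ N (j + 1) := by
      apply mul_left_cancel₀ (cfQ_pos hN i).ne'
      rw [h3, h1, ← h4, h2, mul_comm]
    refine ⟨?_, hQ⟩
    have k1 := sqrt_sub_cfQ_lt hN (i + 1)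
    have k2 := cfP_lt hN (i + 1 + 1)
    have k3 := sqrt_sub_cfQ_succ_lt hN j
    have k4 := cfP_lt hN (j + 1)
    rw [← hQ] at k3
    -- P_{i+2} ≡ −P_{i+1} = −P_{j+2} ≡ P_{j+1} modulo the common Q, and both ends lie in the same
    -- window of length Q.
    refine eq_of_mem_window (k := cfA N (i + 1) - cfA N (j + 1)) k1 k2 k3 k4 ?_
    rw [cfP_succ N (i + 1), h1, cfP_succ N (j + 1), hQ]
    ring

/-- A step length depends only on P, and by symmetry the last k steps of the period are the first k
in reverse order. -/
theorem pathDist_split {τ : ℕ} (hτ : cfQ N τ = 1) {h k : ℕ} (hk : h + k = τ) :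
    (upsilon N 0).pathDist τ = (upsilon N 0).pathDist h + (upsilon N 0).pathDist k := by
  rw [pathDist_upsilon hN, pathDist_upsilon hN, pathDist_upsilon hN, ← hk, Finset.sum_range_add]
  congr 1
  rw [← Finset.sum_range_reflect (fun i => (upsilon N i).stepDist) k]
  refine Finset.sum_congr rfl fun i hi => stepDist_upsilon_congr hN ?_
  rw [Finset.mem_range] at hi
  exact (cf_symmetry hN hτ (h + i) (k - 1 - i) (by omega)).1

/-- Υ_τ = Υ_0 needs τ even because of the sign (−1)^τ. For odd τ the cycle closes only after 2τ
steps, and the two halves have equal length. -/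
theorem pathDist_cfPeriod {ε : Pell.Solution₁ (N : ℤ)} (hε : Pell.IsFundamental ε) :
    (upsilon N 0).pathDist (cfPeriod N) =
      if Even (cfPeriod N) then pellLog ε else pellLog ε / 2 := by
  obtain ⟨h0, hQ, hmin⟩ := cfPeriod_spec hN hε
  obtain ⟨T, hT, hTe, hTR⟩ := exists_cycle_length hN hε
  obtain ⟨hTev, hQT⟩ := (upsilon_eq_zero_iff hN T).1 hTe
  have hle := hmin T hT hQT
  have hmono := pathDist_upsilon_strictMono hN
  have hR := pellLog_pos hε
  have hge : ∀ n, 0 < n → upsilon N n = upsilon N 0 →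
      pellLog ε ≤ (upsilon N 0).pathDist n := by
    intro n hn he
    obtain ⟨k, hk⟩ := exists_pathDist_sub hN hε he.symm
    have h1 := hmono hn
    rw [pathDist_zero] at h1 hk
    rw [zero_add] at hk
    have hk0 : 0 < k := by
      by_contra hle
      have : (k : ℝ) ≤ 0 := by exact_mod_cast not_lt.1 hle
      nlinarith
    have : (1 : ℝ) ≤ k := by exact_mod_cast hk0
    rw [hk]
    nlinarith
  split_ifs with hev
  · apply le_antisymm
    · rw [← hTR]
      exact hmono.monotone hle
    · exact hge _ h0 ((upsilon_eq_zero_iff hN _).2 ⟨hev, hQ⟩)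
  · have hadd := pathDist_add_of_cfQ_eq_one hN hQ (cfPeriod N)
    have hQ2 := (cfP_cfQ_add_of_cfQ_eq_one hN hQ (cfPeriod N)).2
    have h1 := hge (cfPeriod N + cfPeriod N) (by omega)
      ((upsilon_eq_zero_iff hN _).2 ⟨⟨_, rfl⟩, by rw [hQ2, hQ]⟩)
    have hne : cfPeriod N ≠ T := fun h => hev (h ▸ hTev)
    have hsub := (cfP_cfQ_add_of_cfQ_eq_one hN hQ (T - cfPeriod N)).2
    rw [Nat.sub_add_cancel hle, hQT] at hsub
    have h2 := hmin (T - cfPeriod N) (by omega) hsub.symm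
    have h3 := hmono.monotone (by omega : cfPeriod N + cfPeriod N ≤ T)
    rw [hTR] at h3
    linarith

/-- For even τ the two halves of the period are equal and the difference is 0. For odd τ the
distances of Υ_h and Υ_{h+1} add up to R⁺/2, so R⁺/4 lies between them. -/
theorem targetDist_sub_delta {ε : Pell.Solution₁ (N : ℤ)} (hε : Pell.IsFundamental ε) :
    |targetDist N (pellLog ε) - BQForm.delta (upsilon N 0) (upsilon N (cfPeriod N / 2))| ≤
      Real.log (6 * Real.sqrt N) := by
  obtain ⟨h0, hQ, -⟩ := cfPeriod_spec hN hε
  have hτ := pathDist_cfPeriod hN hε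
  have hR := pellLog_pos hε
  have hL := BQForm.log_six_sqrt_pos hN
  have hmono := pathDist_upsilon_strictMono hN
  set h := cfPeriod N / 2 with hh
  have hnn := hmono.monotone (Nat.zero_le h)
  rw [pathDist_zero] at hnn
  have key : 0 ≤ targetDist N (pellLog ε) - (upsilon N 0).pathDist h ∧
      targetDist N (pellLog ε) - (upsilon N 0).pathDist h ≤ Real.log (6 * Real.sqrt N) ∧
      (upsilon N 0).pathDist h < pellLog ε := by
    rw [targetDist]
    rcases Nat.even_or_odd (cfPeriod N) with hev | hodd
    · have := pathDist_split hN hQ (h := h) (k := h) (by obtain ⟨r, hr⟩ := hev; omega)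
      rw [if_pos hev] at hτ ⊢
      refine ⟨?_, ?_, ?_⟩ <;> linarith
    · have := pathDist_split hN hQ (h := h) (k := h + 1) (by obtain ⟨r, hr⟩ := hodd; omega)
      have h2 := pathDist_upsilon_succ hN h
      have h3 := stepDist_upsilon_pos hN h
      have h4 := stepDist_upsilon_le hN h
      rw [if_neg (Nat.not_even_iff_odd.2 hodd)] at hτ ⊢
      refine ⟨?_, ?_, ?_⟩ <;> linarith
  obtain ⟨k1, k2, k3⟩ := key
  obtain ⟨d1, d2, k, hk⟩ := delta_upsilon hN hε h
  have hk0 : k = 0 := by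
    have h1 : -1 < (k : ℝ) := by nlinarith
    have h2 : (k : ℝ) < 1 := by nlinarith
    have h1' : -1 < k := by exact_mod_cast h1
    have h2' : k < 1 := by exact_mod_cast h2
    omega
  rw [hk, hk0, Int.cast_zero, zero_mul, add_zero, abs_of_nonneg k1]
  exact k2

end

/-! ### Analysis of the giant-step phase -/

namespace IsGiantStepRun

variable {N t : ℕ} {D : ℝ} {G : ℕ → BQForm} {d : ℕ → ℝ} {F : ℕ → BQForm} {dbar : ℕ → ℝ}

theorem isPrincipalAt (hN : ¬ IsSquare N) (h : IsGiantStepRun N D t G d F dbar) (i : ℕ)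
    (hi : i ≤ t) : (G i).IsPrincipalAt N (d i) := by
  induction i with
  | zero =>
    obtain ⟨l, -, hG, hd⟩ := h.init
    rw [hG, hd]
    exact upsilon_isPrincipalAt hN l
  | succ i ih =>
    obtain ⟨e, he, hd⟩ := h.square i (by omega)
    have := (he.isPrincipalAt hN (ih (by omega)) (ih (by omega))).1
    rwa [← two_mul, ← hd] at this

theorem abs_sub_two_mul_le (hN : ¬ IsSquare N) (h : IsGiantStepRun N D t G d F dbar) {i : ℕ}
    (hi : i < t) : |d (i + 1) - 2 * d i| ≤ BQForm.giantStepBound N := by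
  obtain ⟨e, he, hd⟩ := h.square i hi
  have hG := h.isPrincipalAt hN i hi.le
  rw [hd, add_sub_cancel_left]
  exact (he.isPrincipalAt hN hG hG).2

/-- Here j counts the indices already treated. At the start D < d_t ≤ 2d_{t−1} + E. Skipping i means
D − dbar < d_i; taking i lowers the gap by d_i, and d_{i+1} − d_i ≤ d_i + E. Each giant step taken
adds at most E to the discrepancy between x and dbar. -/
theorem approx (hN : ¬ IsSquare N) (h : IsGiantStepRun N D t G d F dbar) (j : ℕ) :
    ∀ i, i + j + 1 = t → ∃ x, (F i).IsPrincipalAt N x ∧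
      |x - dbar i| ≤ j * BQForm.giantStepBound N ∧ dbar i ≤ D ∧
      D - dbar i < d i + (j + 1) * BQForm.giantStepBound N := by
  induction j with
  | zero =>
    intro i hi
    obtain rfl : i = t - 1 := by omega
    have h1 := h.abs_sub_two_mul_le hN (by omega : t - 1 < t)
    have h2 := h.target_lt
    have h3 := h.le_target (t - 1) (by omega)
    rw [Nat.sub_add_cancel h.one_le, abs_le] at h1
    obtain ⟨hF, hd⟩ := h.start
    rw [hF, hd]
    refine ⟨d (t - 1), h.isPrincipalAt hN _ (by omega), by simp, h3, ?_⟩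
    push_cast
    linarith
  | succ j ih =>
    intro i hi
    obtain ⟨x, hx, h1, h2, h3⟩ := ih (i + 1) (by omega)
    have hE : 0 ≤ BQForm.giantStepBound N :=
      (abs_nonneg _).trans (h.abs_sub_two_mul_le hN (by omega : i < t))
    have hG := h.isPrincipalAt hN i (by omega)
    push_cast
    rcases lt_or_ge D (dbar (i + 1) + d i) with hlt | hge
    · obtain ⟨hF, hd⟩ := h.skip i (by omega) hlt
      rw [hF, hd]
      have : 0 ≤ ((j : ℝ) + 1 + 1) * BQForm.giantStepBound N := by positivity
      exact ⟨x, hx, by linarith, h2, by linarith⟩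
    · obtain ⟨⟨e, he⟩, hd⟩ := h.take i (by omega) hge
      obtain ⟨h4, h5⟩ := he.isPrincipalAt hN hx hG
      have h6 := h.abs_sub_two_mul_le hN (by omega : i < t)
      rw [abs_le] at h1 h5 h6
      refine ⟨_, h4, ?_, by rw [hd]; exact hge, ?_⟩
      · rw [hd, abs_le]
        constructor <;> linarith
      · rw [hd]
        linarith

theorem d_zero_bounds (hN : ¬ IsSquare N) (h : IsGiantStepRun N D t G d F dbar) :
    2 * Real.log (4 * N) + 1 ≤ d 0 ∧
      d 0 ≤ 2 * Real.log (4 * N) + 1 + Real.log (6 * Real.sqrt N) := by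
  obtain ⟨l, hl, -, hd⟩ := h.init
  rw [hd]
  refine ⟨hl.1, ?_⟩
  have hL := BQForm.log_six_sqrt_pos hN
  rcases l with _ | l
  · have h0 : 0 ≤ Real.log (4 * N) := by
      have : (4 * N : ℝ) = ((4 * N : ℕ) : ℝ) := by push_cast; ring
      rw [this]
      exact Real.log_natCast_nonneg _
    rw [pathDist_zero]
    linarith
  · have h1 : ¬ (2 * Real.log (4 * N) + 1 ≤ (upsilon N 0).pathDist l) := fun hle =>
      absurd (hl.2 hle) (by omega)
    rw [pathDist_upsilon_succ hN]
    linarith [stepDist_upsilon_le hN l]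

end IsGiantStepRun

theorem targetDist_bounds (N : ℕ) {R : ℝ} (hR : 0 ≤ R) :
    R / 4 ≤ targetDist N R ∧ targetDist N R ≤ R / 2 := by
  rw [targetDist]
  split_ifs <;> constructor <;> linarith

namespace IsGiantStepRun

variable {N t : ℕ} {G : ℕ → BQForm} {d : ℕ → ℝ} {F : ℕ → BQForm} {dbar : ℕ → ℝ}
  {ε : Pell.Solution₁ (N : ℤ)}

/-- The position x is within M of D, and R⁺/4 ≤ D ≤ R⁺/2. If R⁺ > 4M, then 0 < x < R⁺, so the
multiple of R⁺ separating x from δ is 0. If R⁺ ≤ 4M, the trivial bound is enough; hence the factor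
4. -/
theorem output (hN : ¬ IsSquare N) (hε : Pell.IsFundamental ε)
    (h : IsGiantStepRun N (targetDist N (pellLog ε)) t G d F dbar) :
    ∃ n, F 0 = upsilon N n ∧
      |targetDist N (pellLog ε) - BQForm.delta (upsilon N 0) (upsilon N n)| ≤ pellLog ε ∧
      |targetDist N (pellLog ε) - BQForm.delta (upsilon N 0) (upsilon N n)| ≤
        4 * (d 0 + 2 * t * BQForm.giantStepBound N) := by
  have ht := h.one_le
  have hR := pellLog_pos hε
  obtain ⟨hD1, hD2⟩ := targetDist_bounds N hR.le
  obtain ⟨x, hx, h1, h2, h3⟩ := h.approx hN (t - 1) 0 (by omega)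
  obtain ⟨n, k, hn, hk⟩ := hx.exists_upsilon hN hε
  obtain ⟨d1, d2, k', hk'⟩ := delta_upsilon hN hε n
  have hE : 0 ≤ BQForm.giantStepBound N :=
    (abs_nonneg _).trans (h.abs_sub_two_mul_le hN (by omega : 0 < t))
  rw [Nat.cast_sub ht, Nat.cast_one] at h1 h3
  set D := targetDist N (pellLog ε)
  set δ := BQForm.delta (upsilon N 0) (upsilon N n)
  set M := d 0 + 2 * t * BQForm.giantStepBound N with hM
  have htriv : |D - δ| ≤ pellLog ε := by
    rw [abs_le]
    constructor <;> linarith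
  refine ⟨n, hn, htriv, ?_⟩
  rcases le_or_gt (pellLog ε) (4 * M) with hle | hgt
  · exact htriv.trans hle
  · have hd0 : 0 ≤ d 0 := by
      have h0 : 0 ≤ Real.log (4 * N) := by
        have : (4 * N : ℝ) = ((4 * N : ℕ) : ℝ) := by push_cast; ring
        rw [this]
        exact Real.log_natCast_nonneg _
      linarith [(h.d_zero_bounds hN).1]
    have htE : 0 ≤ (t : ℝ) * BQForm.giantStepBound N := by positivity
    rw [abs_le] at h1
    have h4 : D - M < x := by linarith
    have h5 : x ≤ D + M := by linarith
    have hk0 : k' + k = 0 := by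
      have e : δ = x + ((k' + k : ℤ) : ℝ) * pellLog ε := by rw [hk', hk]; push_cast; ring
      have h6 : -1 < ((k' + k : ℤ) : ℝ) := by
        by_contra hlt
        rw [not_lt] at hlt
        nlinarith
      have h7 : ((k' + k : ℤ) : ℝ) < 1 := by
        by_contra hlt
        rw [not_lt] at hlt
        nlinarith
      have h6' : -1 < k' + k := by exact_mod_cast h6
      have h7' : k' + k < 1 := by exact_mod_cast h7
      omega
    have e : δ = x := by
      have : ((k' + k : ℤ) : ℝ) = 0 := by rw [hk0, Int.cast_zero]
      push_cast at this
      rw [hk', hk]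
      linear_combination pellLog ε * this
    rw [abs_le]
    constructor <;> linarith

/-- The starting threshold pays for the loss E ≤ 2 ln(4N) of each squaring with 1 to spare, so the
lower bound 2^i for the excess over 2 ln(4N) doubles. -/
theorem growth {D : ℝ} (hN : ¬ IsSquare N) (h : IsGiantStepRun N D t G d F dbar)
    (hE : BQForm.giantStepBound N ≤ 2 * Real.log (4 * N)) (i : ℕ) (hi : i ≤ t) :
    2 * Real.log (4 * N) + 2 ^ i ≤ d i := by
  induction i with
  | zero => simpa using (h.d_zero_bounds hN).1
  | succ i ih =>
    have h1 := ih (by omega)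
    have h2 := h.abs_sub_two_mul_le hN (by omega : i < t)
    rw [abs_le] at h2
    rw [pow_succ]
    linarith

end IsGiantStepRun

/-! ### Existence of runs -/

theorem exists_le_pathDist {N : ℕ} (hN : ¬ IsSquare N) {ε : Pell.Solution₁ (N : ℤ)}
    (hε : Pell.IsFundamental ε) (x : ℝ) : ∃ k, x ≤ (upsilon N 0).pathDist k := by
  obtain ⟨T, -, hTe, hTR⟩ := exists_cycle_length hN hε
  have hQ := ((upsilon_eq_zero_iff hN T).1 hTe).2
  have hmul : ∀ j : ℕ, (upsilon N 0).pathDist (T * j) = j * pellLog ε := by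
    intro j
    induction j with
    | zero => simp [pathDist_zero]
    | succ j ih =>
      rw [mul_add, mul_one, add_comm, pathDist_add_of_cfQ_eq_one hN hQ, ih, hTR]
      push_cast
      ring
  obtain ⟨j, hj⟩ := exists_nat_ge (x / pellLog ε)
  refine ⟨T * j, ?_⟩
  rwa [hmul, ← div_le_iff₀ (pellLog_pos hε)]

theorem exists_isGiantStepRun {N : ℕ} (hN : ¬ IsSquare N) {ε : Pell.Solution₁ (N : ℤ)}
    (hε : Pell.IsFundamental ε) {D : ℝ}
    (hE : BQForm.giantStepBound N ≤ 2 * Real.log (4 * N))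
    (hD : 2 * Real.log (4 * N) + 1 + Real.log (6 * Real.sqrt N) ≤ D) :
    ∃ t G d F dbar, IsGiantStepRun N D t G d F dbar := by
  have hne : {k : ℕ | 2 * Real.log (4 * N) + 1 ≤ (upsilon N 0).pathDist k}.Nonempty :=
    exists_le_pathDist hN hε _
  set l := sInf {k : ℕ | 2 * Real.log (4 * N) + 1 ≤ (upsilon N 0).pathDist k} with hl
  have hleast : IsLeast {k : ℕ | 2 * Real.log (4 * N) + 1 ≤ (upsilon N 0).pathDist k} l :=
    ⟨Nat.sInf_mem hne, fun _ h => Nat.sInf_le h⟩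
  have hlow : 2 * Real.log (4 * N) + 1 ≤ (upsilon N 0).pathDist l := hleast.1
  have hup : (upsilon N 0).pathDist l ≤ D := by
    have hL := BQForm.log_six_sqrt_pos hN
    have h0 : 0 ≤ Real.log (4 * N) := by
      have : (4 * N : ℝ) = ((4 * N : ℕ) : ℝ) := by push_cast; ring
      rw [this]
      exact Real.log_natCast_nonneg _
    rcases hl' : l with _ | m
    · rw [pathDist_zero]
      linarith
    · have h1 : ¬ (2 * Real.log (4 * N) + 1 ≤ (upsilon N 0).pathDist m) := fun hle =>
        absurd (hleast.2 hle) (by omega)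
      rw [pathDist_upsilon_succ hN]
      linarith [stepDist_upsilon_le hN m]
  let S := {p : BQForm × ℝ // p.1.IsPrincipalAt N p.2}
  -- The second component is the nominal dbar, not a position; it is only required that the form has
  -- some position.
  let S' := {p : BQForm × ℝ // ∃ x, p.1.IsPrincipalAt N x}
  have hsq : ∀ p : S, ∃ q : S, ∃ e : ℝ, BQForm.IsGiantStep p.1.1 p.1.1 q.1.1 e ∧
      q.1.2 = 2 * p.1.2 + e ∧ |e| ≤ BQForm.giantStepBound N := by
    intro p
    obtain ⟨H, e, he⟩ := BQForm.exists_isGiantStep hN p.2 p.2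
    obtain ⟨h1, h2⟩ := he.isPrincipalAt hN p.2 p.2
    exact ⟨⟨(H, p.1.2 + p.1.2 + e), h1⟩, e, he, by simp only [two_mul], h2⟩
  have htake : ∀ (p : S') (q : S), ∃ r : S',
      (p.1.2 + q.1.2 ≤ D → (∃ e : ℝ, BQForm.IsGiantStep p.1.1 q.1.1 r.1.1 e) ∧
        r.1.2 = p.1.2 + q.1.2) ∧ (D < p.1.2 + q.1.2 → r = p) := by
    intro p q
    obtain ⟨x, hx⟩ := p.2
    obtain ⟨H, e, he⟩ := BQForm.exists_isGiantStep hN hx q.2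
    rcases le_or_gt (p.1.2 + q.1.2) D with h | h
    · exact ⟨⟨(H, p.1.2 + q.1.2), _, (he.isPrincipalAt hN hx q.2).1⟩,
        fun _ => ⟨⟨e, he⟩, rfl⟩, fun h' => absurd h (not_le.2 h')⟩
    · exact ⟨p, fun h' => absurd h (not_lt.2 h'), fun _ => rfl⟩
  choose f hf using hsq
  choose g hg1 hg2 using htake
  let s : ℕ → S := fun i =>
    f^[i] ⟨(upsilon N l, (upsilon N 0).pathDist l), upsilon_isPrincipalAt hN l⟩
  have hs : ∀ i, s (i + 1) = f (s i) := fun i => Function.iterate_succ_apply' _ _ _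
  have hgrow : ∀ i, 2 * Real.log (4 * N) + 2 ^ i ≤ (s i).1.2 := by
    intro i
    induction i with
    | zero => rwa [pow_zero]
    | succ i ih =>
      obtain ⟨e, -, h2, h3⟩ := hf (s i)
      rw [abs_le] at h3
      rw [hs, h2, pow_succ]
      linarith
  have hex : ∃ i, D < (s i).1.2 := by
    obtain ⟨i, hi⟩ := pow_unbounded_of_one_lt D one_lt_two
    have h0 : 0 ≤ Real.log (4 * N) := by
      have : (4 * N : ℝ) = ((4 * N : ℕ) : ℝ) := by push_cast; ring
      rw [this]
      exact Real.log_natCast_nonneg _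
    exact ⟨i, by linarith [hgrow i]⟩
  classical
  obtain ⟨t, ht⟩ : ∃ t, t = Nat.find hex := ⟨_, rfl⟩
  have ht1 : D < (s t).1.2 := by rw [ht]; exact Nat.find_spec hex
  have ht2 : ∀ i < t, (s i).1.2 ≤ D := fun i hi =>
    not_lt.1 (Nat.find_min hex (by omega))
  have ht0 : 1 ≤ t := by
    rcases Nat.eq_zero_or_pos t with h | h
    · rw [h] at ht1
      exact absurd hup (not_le.2 ht1)
    · exact h
  -- The descent is indexed upwards: w j is the state after treating t − 2, …, t − 1 − j.
  let w : ℕ → S' := fun j =>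
    Nat.rec ⟨(s (t - 1)).1, _, (s (t - 1)).2⟩ (fun j p => g p (s (t - 2 - j))) j
  have hw : ∀ j, w (j + 1) = g (w j) (s (t - 2 - j)) := fun _ => rfl
  have hw' : ∀ i, i + 1 < t → w (t - 1 - i) = g (w (t - 1 - (i + 1))) (s i) := by
    intro i hi
    have h1 : t - 1 - i = t - 1 - (i + 1) + 1 := by omega
    rw [h1, hw]
    congr 2
    omega
  refine ⟨t, fun i => (s i).1.1, fun i => (s i).1.2, fun i => (w (t - 1 - i)).1.1,
    fun i => (w (t - 1 - i)).1.2, ⟨⟨l, hleast, rfl, rfl⟩, ?_, ht2, ht1, ht0, ?_, ?_, ?_⟩⟩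
  · intro i _
    obtain ⟨e, h1, h2, -⟩ := hf (s i)
    refine ⟨e, ?_, ?_⟩
    · rw [hs]; exact h1
    · rw [hs]; exact h2
  · simp only [Nat.sub_self]
    exact ⟨rfl, rfl⟩
  · intro i hi hle
    rw [hw' i hi]
    exact hg1 _ _ hle
  · intro i hi hlt
    rw [hw' i hi, hg2 _ _ hlt]
    exact ⟨rfl, rfl⟩

/-! ### Estimates for large `N` -/

section Estimates

variable {N : ℕ} (hN : ¬ IsSquare N) (hlarge : 100 ≤ Real.log N)
include hN hlarge

theorem log_estimates :
    Real.log (6 * Real.sqrt N) ≤ Real.log N ∧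
    BQForm.giantStepBound N ≤ 2 * Real.log N ∧
    Real.log N ≤ Real.log (4 * N) ∧ Real.log (4 * N) ≤ 3 + Real.log N := by
  have hs := one_lt_sqrt_of_not_isSquare hN
  have hs0 : Real.sqrt N ≠ 0 := by linarith
  have hN0 : (N : ℝ) ≠ 0 := by
    intro h
    rw [h, Real.log_zero] at hlarge
    linarith
  have h6 := Real.log_le_sub_one_of_pos (by norm_num : (0 : ℝ) < 6)
  have h16 := Real.log_le_sub_one_of_pos (by norm_num : (0 : ℝ) < 16)
  have h4 := Real.log_le_sub_one_of_pos (by norm_num : (0 : ℝ) < 4)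
  have h4' : 0 ≤ Real.log 4 := Real.log_nonneg (by norm_num)
  rw [BQForm.giantStepBound, Real.log_mul (by norm_num) hs0, Real.log_mul (by norm_num) hs0,
    Real.log_mul (by norm_num) hN0, Real.log_sqrt (Nat.cast_nonneg N)]
  -- The threshold 100 is used here: `giantStepBound` is (7/4) ln N plus at most 3·5 + 15/2 = 22.5,
  -- and ¼ ln N ≥ 25.
  refine ⟨?_, ?_, ?_, ?_⟩ <;> linarith

theorem log_pellLog_le {ε : Pell.Solution₁ (N : ℤ)} (hε : Pell.IsFundamental ε) :
    Real.log (pellLog ε) ≤ 4 * Real.log N := by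
  have hN0 : (N : ℝ) ≠ 0 := by
    intro h
    rw [h, Real.log_zero] at hlarge
    linarith
  have h1 := pellLog_le hN hε
  have h2 := (log_estimates hN hlarge).1
  have h3 : pellLog ε ≤ 10 * N ^ 2 * Real.log N := h1.trans (by gcongr)
  have h4 := Real.log_le_log (pellLog_pos hε) h3
  have h5 : Real.log N ≠ 0 := by linarith
  rw [Real.log_mul (by positivity) h5, Real.log_mul (by norm_num) (by positivity),
    Real.log_pow] at h4
  have h6 := Real.log_le_sub_one_of_pos (by norm_num : (0 : ℝ) < 10)
  have h7 := Real.log_le_sub_one_of_pos (by linarith : 0 < Real.log N)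
  push_cast at h4
  linarith

theorem IsGiantStepRun.error_le {ε : Pell.Solution₁ (N : ℤ)} (hε : Pell.IsFundamental ε) {t : ℕ}
    {G : ℕ → BQForm} {d : ℕ → ℝ} {F : ℕ → BQForm} {dbar : ℕ → ℝ}
    (h : IsGiantStepRun N (targetDist N (pellLog ε)) t G d F dbar) :
    4 * (d 0 + 2 * t * BQForm.giantStepBound N) ≤ 160 * Real.log N ^ 2 := by
  obtain ⟨h1, h2, h3, h4⟩ := log_estimates hN hlarge
  have hR := pellLog_pos hε
  have ht0 := h.one_le
  have hd0 := (h.d_zero_bounds hN).2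
  have hgrow := h.growth hN (by linarith) (t - 1) (by omega)
  have hle := h.le_target (t - 1) (by omega)
  have hpow : (2 : ℝ) ^ (t - 1) ≤ pellLog ε := by
    linarith [(targetDist_bounds N hR.le).2]
  have hlog := Real.log_le_log (by positivity) hpow
  rw [Real.log_pow, Nat.cast_sub ht0, Nat.cast_one] at hlog
  have hlog2 := Real.log_two_gt_d9
  have hlogR := log_pellLog_le hN hlarge hε
  have ht1 : (1 : ℝ) ≤ t := by exact_mod_cast ht0
  -- From 2^(t−1) ≤ R⁺, ln 2 > ½ and ln R⁺ ≤ 4 ln N: t ≤ 8 ln N + 1.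
  have ht : (t : ℝ) ≤ 9 * Real.log N := by
    have : ((t : ℝ) - 1) * (1 / 2) ≤ (t - 1) * Real.log 2 :=
      mul_le_mul_of_nonneg_left (by linarith) (by linarith)
    linarith
  have htE : (t : ℝ) * BQForm.giantStepBound N ≤ 9 * Real.log N * (2 * Real.log N) :=
    (mul_le_mul_of_nonneg_left h2 (by linarith)).trans
      (mul_le_mul_of_nonneg_right ht (by linarith))
  nlinarith

end Estimates

/-- The regulators are bounded for bounded `N`. -/
theorem exists_pellLog_bound (N₀ : ℕ) : ∃ S : ℝ, 0 ≤ S ∧ ∀ (N : ℕ) (ε : Pell.Solution₁ (N : ℤ)),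
    N < N₀ → Pell.IsFundamental ε → pellLog ε ≤ S := by
  induction N₀ with
  | zero => exact ⟨0, le_rfl, fun N ε h => absurd h (Nat.not_lt_zero N)⟩
  | succ n ih =>
    obtain ⟨S, hS0, hS⟩ := ih
    by_cases hex : ∃ ε : Pell.Solution₁ (n : ℤ), Pell.IsFundamental ε
    · obtain ⟨ε₀, hε₀⟩ := hex
      refine ⟨max S (pellLog ε₀), hS0.trans (le_max_left _ _), fun N ε hlt hε => ?_⟩
      rcases Nat.lt_succ_iff_lt_or_eq.1 hlt with h | rfl
      · exact (hS N ε h hε).trans (le_max_left _ _)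
      · rw [hε.subsingleton hε₀]
        exact le_max_right _ _
    · refine ⟨S, hS0, fun N ε hlt hε => ?_⟩
      rcases Nat.lt_succ_iff_lt_or_eq.1 hlt with h | rfl
      · exact hS N ε h hε
      · exact absurd ⟨ε, hε⟩ hex

theorem mainTheorem5 :
    ∃ (C : ℝ) (N₀ : ℕ), ∀ (N : ℕ) (ε : Pell.Solution₁ (N : ℤ)),
      Odd N → 1 < N → ¬ N.Prime → ¬ IsSquare N →
      Pell.IsFundamental ε → (Real.log N) ^ 2 < pellLog ε →
      (N₀ ≤ N → ∃ t G d F dbar,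
        IsGiantStepRun N (targetDist N (pellLog ε)) t G d F dbar) ∧
      ∀ (t : ℕ) (G : ℕ → BQForm) (d : ℕ → ℝ) (F : ℕ → BQForm) (dbar : ℕ → ℝ),
        IsGiantStepRun N (targetDist N (pellLog ε)) t G d F dbar →
        (∃ n : ℕ, F 0 = upsilon N n) ∧
        |targetDist N (pellLog ε) - BQForm.delta (upsilon N 0) (F 0)|
          ≤ C * (Real.log N) ^ 2 ∧
        |BQForm.delta (upsilon N 0) (upsilon N (cfPeriod N / 2))
            - BQForm.delta (upsilon N 0) (F 0)|
          ≤ C * (Real.log N) ^ 2 := by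
  obtain ⟨N₀, hN₀⟩ := exists_nat_gt (Real.exp 100)
  obtain ⟨S, hS0, hS⟩ := exists_pellLog_bound N₀
  -- The 160 is from `IsGiantStepRun.error_le`, 1 more covers the offset of the middle form, and S
  -- bounds R⁺ for N < N₀.
  refine ⟨161 + S, N₀, fun N ε hodd h1 _ hN hε hR => ?_⟩
  have hlarge : N₀ ≤ N → 100 ≤ Real.log N := fun h => by
    have h2 : (N₀ : ℝ) ≤ N := by exact_mod_cast h
    rw [Real.le_log_iff_exp_le (by linarith [Real.exp_pos 100])]
    linarith
  have hℓ : 1 ≤ Real.log N := by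
    have h3 : (3 : ℝ) ≤ N := by
      obtain ⟨r, hr⟩ := hodd
      have : 3 ≤ N := by omega
      exact_mod_cast this
    rw [Real.le_log_iff_exp_le (by linarith)]
    linarith [Real.exp_one_lt_d9]
  have hℓ2 : Real.log N ≤ Real.log N ^ 2 := by nlinarith
  have hR0 := pellLog_pos hε
  obtain ⟨hD1, hD2⟩ := targetDist_bounds N hR0.le
  refine ⟨fun h => ?_, fun t G d F dbar h => ?_⟩
  · obtain ⟨k1, k2, k3, k4⟩ := log_estimates hN (hlarge h)
    have := hlarge h
    exact exists_isGiantStepRun hN hε (by linarith) (by nlinarith)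
  · obtain ⟨n, hn, htriv, herr⟩ := h.output hN hε
    obtain ⟨e1, e2, -⟩ := delta_upsilon hN hε n
    obtain ⟨e3, e4, -⟩ := delta_upsilon hN hε (cfPeriod N / 2)
    refine ⟨⟨n, hn⟩, ?_⟩
    rw [hn]
    have hSℓ : 0 ≤ S * Real.log N ^ 2 := by positivity
    rcases lt_or_ge N N₀ with hlt | hge
    -- For small N all the distances lie in [0, R⁺], and ln N ≥ 1 since N ≥ 3.
    · have hRS := hS N ε hlt hε
      have hb : pellLog ε ≤ (161 + S) * Real.log N ^ 2 := by nlinarith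
      refine ⟨htriv.trans hb, le_trans ?_ hb⟩
      rw [abs_le]
      constructor <;> linarith
    · have herr' := herr.trans (h.error_le hN (hlarge hge) hε)
      have htarget := targetDist_sub_delta hN hε
      have hL := (log_estimates hN (hlarge hge)).1
      refine ⟨by linarith [sq_nonneg (Real.log N)], ?_⟩
      rw [abs_le] at herr' htarget ⊢
      constructor <;> linarith
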